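/- Let $p_+,p_-\ge 1$ be coprime integers with $p_+\neq p_-$. Put $\alpha_+=\sqrt{2p_- /p_+}$, $\alpha_-=-\sqrt{2p_+/p_-}$, $\alpha_0=\alpha_++\alpha_-$, $\alpha=\sqrt{2p_+p_-}$, $c=1-3\alpha_0^2$ and $\alpha_{r,s;n}=\frac{1-r}{2}\alpha_++\frac{1-s}{2}\alpha_-+\frac n2\alpha$. Write $q^x=e^{2\pi i\tau x}$ for $\tau\in\mathbb H$. Let $\mathrm{ch}[\mathcal F_\lambda](\tau)=\mathrm{tr}_{\mathcal F_\lambda}q^{L(0)-c/24}$ be the character of the Heisenberg Fock module $\mathcal F_\lambda$, on which $L(0)=\frac12\lambda(\lambda-\alpha_0)+\sum_{k\ge1}a_{-k}a_k$, and write $\mathcal F_{r,s;n}=\mathcal F_{\alpha_{r,s;n}}$. For $\epsilon\in\mathbb C$ set $\mathrm{ch}[\mathcal F_\lambda^\epsilon]=e^{2\pi\epsilon(\lambda-\alpha_0/2)}\mathrm{ch}[\mathcal F_\lambda]$. The minimal model characters are $\mathrm{ch}[\mathcal L_{r,s}]=\sum_{k\in\mathbb Z}\big(\mathrm{ch}[\mathcal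 F_{r,s;2k}]-\mathrm{ch}[\mathcal F_{p_+-r,s;2k+1}]\big)$. For $n\in\mathbb Z$ the regularised characters of the atypical singlet modules $\mathcal I_{r,s;n}$ are defined as follows. * For $1\le r<p_+$, $1\le s<p_-$: $$\mathrm{ch}[\mathcal I^\epsilon_{r,s;n}]=n\,\delta_{n\ge0}\big(\delta_{n\,\mathrm{even}}\mathrm{ch}[\mathcal L_{r,s}]-\delta_{n\,\mathrm{odd}}\mathrm{ch}[\mathcal L_{r,p_--s}]\big)+\sum_{k\ge0}(k+1)\Big(\mathrm{ch}[\mathcal F^\epsilon_{p_+-r,s;n-2k-1}]+\mathrm{ch}[\mathcal F^\epsilon_{r,p_--s;n-2k-3}]-\mathrm{ch}[\mathcal F^\epsilon_{r,s;n-2k-2}]-\mathrm{ch}[\mathcal F^\epsilon_{p_+-r,p_--s;n-2k-2}]\Big).$$ * For $1\le r<p_+$: $\mathrm{ch}[\mathcal I^\epsilon_{r,p_-;n}]=\sum_{k\ge0}\big(\mathrm{ch}[\mathcal F^\epsilon_{p_+-r,p_-;n-2k-1}]-\mathrm{ch}[\mathcal F^\epsilon_{r,p_-;n-2k-2}]\big)$.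 * For $1\le s<p_-$: $\mathrm{ch}[\mathcal I^\epsilon_{p_+,s;n}]=\sum_{k\ge0}\big(\mathrm{ch}[\mathcal F^\epsilon_{p_+,s;n-2k}]-\mathrm{ch}[\mathcal F^\epsilon_{p_+,p_--s;n-2k-1}]\big)$. * $\mathrm{ch}[\mathcal I^\epsilon_{p_+,p_-;n}]=\mathrm{ch}[\mathcal F^\epsilon_{p_+,p_-;n}]$. Let $\mathcal T=\{(r',s'):1\le r'<p_+,\,1\le s'<p_-,\,r'p_-<s'p_+\}$ and $$S^{\rm Vir}_{(r,s),(r',s')}=(-1)^{(r+s)(r'+s')}\sqrt{\tfrac{8}{p_+p_-}}\,\sin\tfrac{\pi rr'(p_--p_+)}{p_+}\,\sin\tfrac{\pi ss'(p_--p_+)}{p_-}.$$ Let $\theta_{a,b}(u,\tau)=\sum_{k\in\mathbb Z}e^{2\pi iu(k+b/2a)}q^{a(k+b/2a)^2}$, and let $\eta$ be the Dedekind eta function. **Theorem.** Let $1\le r\le p_+$, $1\le s\le p_-$, $n\in\mathbb Z$, $\tau\in\mathbb H$ and $\epsilon\in\mathbb C$ with $\mathrm{Re}\,\epsilon\ne0$.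 Then $$\mathrm{ch}[\mathcal I^\epsilon_{r,s;n}]\big(-\tfrac1\tau\big)=n\,\delta_{n\ge0}\sum_{(r',s')\in\mathcal T}(-1)^{n(p_+s'+p_-r')}S^{\rm Vir}_{(r,s),(r',s')}\mathrm{ch}[\mathcal L_{r',s'}](\tau)+\int_{\mathbb R}S^\epsilon_{r,s;n}(x)\,\mathrm{ch}[\mathcal F^\epsilon_{x+\alpha_0/2}](\tau)\,dx+\frac{1-\mathrm{sgn}(\mathrm{Re}\,\epsilon)}{2}\,Y^\epsilon_{r,s;n}(\tau),$$ where the integral converges absolutely, $$S^\epsilon_{r,s;n}(x)=e^{-2\pi\epsilon x}e^{-\pi in\alpha(x+i\epsilon)}\,\frac{\sin\!\big(2\pi rp_-\frac{x+i\epsilon}{\alpha}\big)\sin\!\big(2\pi sp_+\frac{x+i\epsilon}{\alpha}\big)}{\sin^2\!\big(\pi\alpha(x+i\epsilon)\big)}$$ and, writing for a weight $w$ $$\Theta_w(\epsilon)=q^{-\epsilon^2/2}\sum_{m=0}^{2p_+p_--1}(-1)^{mn}\,w(m)\,\frac{\theta_{p_+p_-,m}(i\alpha\epsilon\tau,\tau)}{\eta(\tau)},\qquad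 A=\frac{\pi rm}{p_+},\quad B=\frac{\pi sm}{p_-},$$ $$Y^\epsilon_{r,s;n}(\tau)=\frac1{\pi p_+p_-}\frac{d}{d\epsilon}\Theta_{\sin A\sin B}(\epsilon)-\frac{2n}{\alpha}\,\Theta_{\sin A\sin B}(\epsilon)+\frac{2ri}{p_+\alpha}\,\Theta_{\cos A\sin B}(\epsilon)+\frac{2si}{p_-\alpha}\,\Theta_{\sin A\cos B}(\epsilon),$$ the function $\Theta_{\sin A\sin B}$ being complex differentiable at $\epsilon$. -/

import Mathlib

noncomputable section

namespace Singlet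

/-- `qpow x τ = q ^ x` where `q = exp (2 π i τ)`. -/
def qpow (x τ : ℂ) : ℂ := Complex.exp (2 * Real.pi * Complex.I * τ * x)

/-- `α₊ = √(2 p₋ / p₊)`. -/
def alphaPlus (pp pm : ℕ) : ℝ := Real.sqrt (2 * pm / pp)

/-- `α₋ = -√(2 p₊ / p₋)`. -/
def alphaMinus (pp pm : ℕ) : ℝ := -Real.sqrt (2 * pp / pm)

/-- `α₀ = α₊ + α₋`. -/
def alphaZero (pp pm : ℕ) : ℝ := alphaPlus pp pm + alphaMinus pp pm

/-- `α = √(2 p₊ p₋)`. -/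
def alphaFull (pp pm : ℕ) : ℝ := Real.sqrt (2 * pp * pm)

/-- `α_{r,s;n} = (1 - r)/2 α₊ + (1 - s)/2 α₋ + n/2 α`. -/
def alphaRSN (pp pm : ℕ) (r s n : ℤ) : ℝ :=
  (1 - r) / 2 * alphaPlus pp pm + (1 - s) / 2 * alphaMinus pp pm + n / 2 * alphaFull pp pm

/-- The central charge `c = 1 - 3 α₀²`. -/
def centralCharge (pp pm : ℕ) : ℝ := 1 - 3 * alphaZero pp pm ^ 2

/-- The underlying space of each Fock module: polynomials in the creation operators `a_{-k}`,
`k ≥ 1` (the variable `X k`), applied to the highest weight vector (the constant `1`).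
The annihilation operator `a_k` acts as `k ∂/∂(X k)` and `a_0` acts as `lam` on `F_lam`. -/
abbrev FockSpace : Type := MvPolynomial ℕ+ ℂ

/-- The operator `L(0) = (a_0² - α₀ a_0)/2 + ∑_{k ≥ 1} a_{-k} a_k` on the Fock module `F_lam`;
the sum over `k` is the derivation that sends `X k` to `k X k`. -/
def fockL0 (pp pm : ℕ) (lam : ℂ) : Module.End ℂ FockSpace :=
  (lam * (lam - alphaZero pp pm) / 2) • LinearMap.id +
    (MvPolynomial.mkDerivation ℂ
      (fun k : ℕ+ => ((k : ℕ) : ℂ) • (MvPolynomial.X k : FockSpace))).toLinearMap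

/-- The character `tr q ^ (L(0) - c/24)` of the Fock module `F_lam`, the trace being the sum
over all eigenvalues `h` of the (diagonalisable) operator `L(0)`. -/
def fockCh (pp pm : ℕ) (lam τ : ℂ) : ℂ :=
  ∑' h : ℂ, (Module.finrank ℂ (Module.End.eigenspace (fockL0 pp pm lam) h) : ℂ) *
    qpow (h - centralCharge pp pm / 24) τ

/-- The regularised Fock character `ch[F_lam^ε] = exp (2 π ε (lam - α₀/2)) ch[F_lam]`. -/
def regFockCh (pp pm : ℕ) (ε lam τ : ℂ) : ℂ :=
  Complex.exp (2 * Real.pi * ε * (lam - alphaZero pp pm / 2)) * fockCh pp pm lam τ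

/-- `ch[F_{r,s;n}^ε]`. -/
def regFFCh (pp pm : ℕ) (ε : ℂ) (r s n : ℤ) (τ : ℂ) : ℂ :=
  regFockCh pp pm ε (alphaRSN pp pm r s n) τ

/-- The character of the irreducible minimal model module `L_{r,s}`, as the Euler-Poincaré
alternating sum `∑_{k ∈ ℤ} ch[F_{r,s;2k}] - ch[F_{p₊-r,s;2k+1}]` over its Felder complex. -/
def virCh (pp pm : ℕ) (r s : ℤ) (τ : ℂ) : ℂ :=
  ∑' k : ℤ, (fockCh pp pm (alphaRSN pp pm r s (2 * k)) τ -
    fockCh pp pm (alphaRSN pp pm (pp - r) s (2 * k + 1)) τ)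

/-- The regularised character of `I⁺_{r,s;n}`, for `1 ≤ r < p₊`, `1 ≤ s ≤ p₋`. -/
def regIPlusCh (pp pm : ℕ) (ε : ℂ) (r s n : ℤ) (τ : ℂ) : ℂ :=
  (if s ≠ pm ∧ 1 ≤ n then
    (if Even n then virCh pp pm r s τ else -virCh pp pm r (pm - s) τ) else 0) +
  ∑' k : ℕ, (regFFCh pp pm ε (pp - r) s (n - 2 * k - 1) τ -
    regFFCh pp pm ε r s (n - 2 * k - 2) τ)

/-- The regularised character of `I⁻_{r,s;n}`, for `1 ≤ r ≤ p₊`, `1 ≤ s < p₋`. -/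
def regIMinusCh (pp pm : ℕ) (ε : ℂ) (r s n : ℤ) (τ : ℂ) : ℂ :=
  (if r ≠ pp ∧ 0 ≤ n then
    (if Even n then -virCh pp pm r s τ else virCh pp pm r (pm - s) τ) else 0) +
  ∑' k : ℕ, (regFFCh pp pm ε r s (n - 2 * k) τ -
    regFFCh pp pm ε r (pm - s) (n - 2 * k - 1) τ)

/-- The regularised character of `I_{r,s;n}`, for `1 ≤ r ≤ p₊`, `1 ≤ s ≤ p₋`. On the border,
`I_{p₊,p₋;n} = F_{p₊,p₋;n}`, `I_{r,p₋;n} = I⁺_{r,p₋;n}` and `I_{p₊,s;n} = I⁻_{p₊,s;n}`. -/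
def regICh (pp pm : ℕ) (ε : ℂ) (r s n : ℤ) (τ : ℂ) : ℂ :=
  if r = pp ∧ s = pm then regFFCh pp pm ε r s n τ
  else if s = pm then regIPlusCh pp pm ε r s n τ
  else if r = pp then regIMinusCh pp pm ε r s n τ
  else
    (if 0 ≤ n then
      (n : ℂ) * (if Even n then virCh pp pm r s τ else -virCh pp pm r (pm - s) τ) else 0) +
    ∑' k : ℕ, ((k : ℂ) + 1) *
      (regFFCh pp pm ε (pp - r) s (n - 2 * k - 1) τ +
        regFFCh pp pm ε r (pm - s) (n - 2 * k - 3) τ -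
        regFFCh pp pm ε r s (n - 2 * k - 2) τ -
        regFFCh pp pm ε (pp - r) (pm - s) (n - 2 * k - 2) τ)

/-- The theta function `θ_{a,b}(u,τ) = ∑_{k ∈ ℤ} z ^ (k + b/(2a)) q ^ (a (k + b/(2a))²)`, with
`z = exp (2 π i u)`. -/
def thetaFun (a : ℕ) (b : ℤ) (u τ : ℂ) : ℂ :=
  ∑' k : ℤ, Complex.exp (2 * Real.pi * Complex.I * u * (k + b / (2 * a))) *
    qpow (a * ((k : ℂ) + b / (2 * a)) ^ 2) τ

/-- The Kac table labels `(r', s')`: `1 ≤ r' < p₊`, `1 ≤ s' < p₋`, `r' p₋ < s' p₊`. -/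
def kacTable (pp pm : ℕ) : Finset (ℤ × ℤ) :=
  (Finset.Ico (1 : ℤ) pp ×ˢ Finset.Ico (1 : ℤ) pm).filter (fun x => x.1 * pm < x.2 * pp)

/-- The modular `S`-matrix of the minimal model. -/
def virS (pp pm : ℕ) (r s r' s' : ℤ) : ℝ :=
  (-1 : ℝ) ^ ((r + s) * (r' + s')) * Real.sqrt (8 / (pp * pm)) *
    Real.sin (Real.pi * r * r' * (pm - pp) / pp) * Real.sin (Real.pi * s * s' * (pm - pp) / pm)

/-- The kernel `S^ε_{r,s;n}(x)`. -/
def kernelS (pp pm : ℕ) (ε : ℂ) (r s n : ℤ) (x : ℝ) : ℂ :=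
  Complex.exp (-2 * Real.pi * ε * x) *
    Complex.exp (-Real.pi * Complex.I * n * alphaFull pp pm * (x + Complex.I * ε)) *
    (Complex.sin (2 * Real.pi * r * pm * ((x + Complex.I * ε) / alphaFull pp pm)) *
      Complex.sin (2 * Real.pi * s * pp * ((x + Complex.I * ε) / alphaFull pp pm))) /
    Complex.sin (Real.pi * alphaFull pp pm * (x + Complex.I * ε)) ^ 2

/-- `q ^ (-ε²/2) ∑_{m=0}^{2p₊p₋-1} (-1)^(mn) w(m) θ_{p₊p₋,m}(i √(2p₊p₋) ε τ, τ) / η(τ)`. -/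
def thetaSum (pp pm : ℕ) (n : ℤ) (w : ℕ → ℝ) (ε τ : ℂ) : ℂ :=
  qpow (-ε ^ 2 / 2) τ * ∑ m ∈ Finset.range (2 * pp * pm), (-1 : ℂ) ^ ((m : ℤ) * n) * (w m : ℂ) *
    (thetaFun (pp * pm) m (Complex.I * alphaFull pp pm * ε * τ) τ / ModularForm.eta τ)

/-- `sin (π r m / p₊) sin (π s m / p₋)`. -/
def weightSinSin (pp pm : ℕ) (r s : ℤ) (m : ℕ) : ℝ :=
  Real.sin (Real.pi * (r * m / pp)) * Real.sin (Real.pi * (s * m / pm))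

/-- `cos (π r m / p₊) sin (π s m / p₋)`. -/
def weightCosSin (pp pm : ℕ) (r s : ℤ) (m : ℕ) : ℝ :=
  Real.cos (Real.pi * (r * m / pp)) * Real.sin (Real.pi * (s * m / pm))

/-- `sin (π r m / p₊) cos (π s m / p₋)`. -/
def weightSinCos (pp pm : ℕ) (r s : ℤ) (m : ℕ) : ℝ :=
  Real.sin (Real.pi * (r * m / pp)) * Real.cos (Real.pi * (s * m / pm))

/-- The correction term `Y^ε_{r,s;n}(τ)`. -/
def correctionY (pp pm : ℕ) (ε : ℂ) (r s n : ℤ) (τ : ℂ) : ℂ :=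
  1 / (Real.pi * pp * pm) * deriv (fun e => thetaSum pp pm n (weightSinSin pp pm r s) e τ) ε -
    2 * n / alphaFull pp pm * thetaSum pp pm n (weightSinSin pp pm r s) ε τ +
    2 * r * Complex.I / pp / alphaFull pp pm * thetaSum pp pm n (weightCosSin pp pm r s) ε τ +
    2 * s * Complex.I / pm / alphaFull pp pm * thetaSum pp pm n (weightSinCos pp pm r s) ε τ

end Singlet

end

/-!
Every Fock character is a Gaussian over `η`: the `L(0)`-eigenspaces are spanned by monomials, and
Euler's product for partitions gives `ch[F_λ] = q ^ ((λ - α₀/2)² / 2) / η` (`fockCh_eq`). With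
`a = r / p₊` and `b = s / p₋` the weight of `F_{r,s;n}` is `α₀/2 + α (n - a + b) / 2`, and after
telescoping on the border of the Kac table all four cases of the definition of `ch[I^ε_{r,s;n}]`
become one series `∑_{K ≥ 0} K Q_K` plus a multiple of a minimal model character (`regICh_eq`),
where `Q_K` (`quadTerm`) is a signed sum of the Fock characters with `n - 2K ± a ± b` in place of
`n - a + b`.

The modular transformation of the series rests on the Fourier transform of the Gaussian. At `-1/τ`,
`Q_K` is the integral of a fixed Gaussian numerator times `-4 y ^ K`, with
`y = exp (2πiα(x + iε))`. The modulus of `y` does not depend on `x`; it is less than `1` if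
`Re ε > 0` and greater than `1` if `Re ε < 0`. In the first case
`-4 ∑_{K ≥ 0} K y ^ K = 1 / sin² (πα(x + iε))` converges and integrates term by term to the
asserted integral. In the second case the same function is `4 ∑_{K ≤ 0} K y ^ K`, so that the
integral equals `-∑_{K ≤ 0} K Q_K`, and the series differs from it by the two-sided sum
`∑_{K ∈ ℤ} K Q_K` (`hasSum_quadTerm`, `tsum_nat_mul_quadTerm`). No contour is moved. The two-sided
sum is a first moment of a theta series; the functional equations of Jacobi's theta function and of
its derivative evaluate it as `Y^ε_{r,s;n}` (`tsum_mul_fockTerm`, `tsum_mul_quadTerm`).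

For the minimal model characters, Poisson summation gives
`η⁻¹ ∑_M sin (πrM/p₊) sin (πsM/p₋) q ^ (M² / 4p₊p₋)` up to a constant. The coefficient is even,
periodic modulo `2p₊p₋`, and vanishes on multiples of `p₊` or `p₋`; by coprimality the remaining
residue classes are represented by `±s' p₊ ± r' p₋` with `(r', s')` in the Kac table
(`sum_corner_eq`), which regroups the series into the characters `ch[L_{r',s'}]`
(`virCh_neg_one_div`). On the border of the Kac table these coefficients vanish, in agreement with
the absence of a minimal model term there.
-/

noncomputable section

namespace Singlet

open Complex Filter Topology MeasureTheory

/-! ### Characters of Fock modules -/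

/-- The energy `∑ k · d k` of the monomial with exponents `d` above the highest weight vector. -/
def energy : (ℕ+ →₀ ℕ) →+ ℕ := Finsupp.weight (fun k : ℕ+ => (k : ℕ))

lemma energy_single (k : ℕ+) (j : ℕ) : energy (Finsupp.single k j) = j * k := by
  simp [energy, Finsupp.weight_single]

lemma mkDerivation_monomial_energy (d : ℕ+ →₀ ℕ) (r : ℂ) :
    MvPolynomial.mkDerivation ℂ
      (fun k : ℕ+ => ((k : ℕ) : ℂ) • (MvPolynomial.X k : FockSpace)) (MvPolynomial.monomial d r) =
      (energy d : ℂ) • MvPolynomial.monomial d r := by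
  rw [MvPolynomial.mkDerivation_monomial]
  have h : ∀ k ∈ d.support, (MvPolynomial.monomial (d - Finsupp.single k 1)) ((d k : ℕ) : ℂ) •
      (((k : ℕ) : ℂ) • (MvPolynomial.X k : FockSpace)) =
      MvPolynomial.monomial d ((d k : ℂ) * ((k : ℕ) : ℂ)) := by
    intro k hk
    have h1 : d - Finsupp.single k 1 + Finsupp.single k 1 = d := by
      apply tsub_add_cancel_of_le
      rw [Finsupp.single_le_iff]
      exact Nat.one_le_iff_ne_zero.mpr (Finsupp.mem_support_iff.mp hk)
    rw [MvPolynomial.X, MvPolynomial.smul_monomial, smul_eq_mul, MvPolynomial.monomial_mul, h1]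
    simp
  rw [Finsupp.sum, Finset.sum_congr rfl h, ← map_sum, MvPolynomial.smul_monomial,
    MvPolynomial.smul_monomial]
  congr 1
  simp only [energy, Finsupp.weight_apply, Finsupp.sum, smul_eq_mul, Nat.cast_sum, Nat.cast_mul]
  ring

lemma coeff_fockL0 (pp pm : ℕ) (lam : ℂ) (p : FockSpace) (d : ℕ+ →₀ ℕ) :
    MvPolynomial.coeff d (fockL0 pp pm lam p) =
      (lam * (lam - alphaZero pp pm) / 2 + energy d) * MvPolynomial.coeff d p := by
  induction p using MvPolynomial.induction_on' with
  | monomial e r =>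
    simp only [fockL0, LinearMap.add_apply, LinearMap.smul_apply, LinearMap.id_apply,
      Derivation.coeFn_coe, mkDerivation_monomial_energy, ← add_smul, MvPolynomial.coeff_smul,
      MvPolynomial.coeff_monomial, smul_eq_mul]
    split_ifs with h
    · rw [h]
    · simp
  | add p q hp hq => rw [map_add, MvPolynomial.coeff_add, hp, hq, MvPolynomial.coeff_add, mul_add]

/-- `L(0)` is diagonal in the basis of monomials. -/
lemma eigenspace_fockL0 (pp pm : ℕ) (lam h : ℂ) :
    Module.End.eigenspace (fockL0 pp pm lam) h = MvPolynomial.restrictSupport ℂ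
      ((fun d : ℕ+ →₀ ℕ => lam * (lam - alphaZero pp pm) / 2 + energy d) ⁻¹' {h}) := by
  ext p
  rw [Module.End.mem_eigenspace_iff, MvPolynomial.mem_restrictSupport_iff, MvPolynomial.ext_iff]
  simp only [coeff_fockL0, MvPolynomial.coeff_smul, smul_eq_mul, Set.subset_def, Finset.mem_coe,
    MvPolynomial.mem_support_iff, Set.mem_preimage, Set.mem_singleton_iff]
  refine forall_congr' fun d => ?_
  rw [mul_eq_mul_right_iff]
  tauto

lemma finrank_eigenspace_fockL0 (pp pm : ℕ) (lam h : ℂ) :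
    Module.finrank ℂ (Module.End.eigenspace (fockL0 pp pm lam) h) = Nat.card
      ((fun d : ℕ+ →₀ ℕ => lam * (lam - alphaZero pp pm) / 2 + energy d) ⁻¹' {h}) := by
  rw [eigenspace_fockL0]
  exact Module.finrank_eq_nat_card_basis (MvPolynomial.basisRestrictSupport ℂ _)

/-- Exponents supported on `insert k s` are a multiplicity of `k` and exponents supported on `s`. -/
def insertSupportEquiv {s : Finset ℕ+} {k : ℕ+} (hk : k ∉ s) :
    ℕ × {d : ℕ+ →₀ ℕ // d.support ⊆ s} ≃ {d : ℕ+ →₀ ℕ // d.support ⊆ insert k s} where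
  toFun x := ⟨x.2.1 + Finsupp.single k x.1, by
    refine Finsupp.support_add.trans (Finset.union_subset ?_ ?_)
    · exact x.2.2.trans (Finset.subset_insert _ _)
    · exact Finsupp.support_single_subset.trans (by simp)⟩
  invFun d := (d.1 k, ⟨d.1.erase k, by
    rw [Finsupp.support_erase, ← Finset.subset_insert_iff]
    exact d.2⟩)
  left_inv x := by
    have h : x.2.1 k = 0 := by
      by_contra h
      exact hk (x.2.2 (Finsupp.mem_support_iff.mpr h))
    refine Prod.ext (by simp [h]) (Subtype.ext ?_)
    ext i
    by_cases hi : i = k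
    · subst hi; simp [h]
    · simp [Finsupp.erase_ne hi]
  right_inv d := Subtype.ext (Finsupp.erase_add_single k d.1)

/-- Euler's product restricted to finitely many creation operators. -/
lemma tsum_pow_energy_support {q : ℂ} (hq : ‖q‖ < 1) (s : Finset ℕ+) :
    Summable (fun d : {d : ℕ+ →₀ ℕ // d.support ⊆ s} => ‖q ^ energy d.1‖) ∧
    ∑' d : {d : ℕ+ →₀ ℕ // d.support ⊆ s}, q ^ energy d.1 = ∏ k ∈ s, (1 - q ^ (k : ℕ))⁻¹ := by
  induction s using Finset.induction_on with
  | empty =>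
    have : Unique {d : ℕ+ →₀ ℕ // d.support ⊆ ∅} :=
      { default := ⟨0, by simp⟩
        uniq := fun d => Subtype.ext (by simpa using d.2) }
    refine ⟨Summable.of_finite, ?_⟩
    rw [tsum_fintype, Fintype.sum_unique]
    have : ((default : {d : ℕ+ →₀ ℕ // d.support ⊆ ∅})).1 = 0 := by
      simpa using (default : {d : ℕ+ →₀ ℕ // d.support ⊆ ∅}).2
    simp [this]
  | insert k s hk ih =>
    have hqk : ‖q ^ (k : ℕ)‖ < 1 := by
      rw [norm_pow]; exact pow_lt_one₀ (norm_nonneg _) hq k.ne_zero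
    have hg : Summable fun j : ℕ => ‖(q ^ (k : ℕ)) ^ j‖ := by
      simpa [norm_pow] using summable_geometric_of_lt_one (norm_nonneg _) hqk
    have e : ∀ x, q ^ energy (insertSupportEquiv hk x).1 =
        (q ^ (k : ℕ)) ^ x.1 * q ^ energy x.2.1 := by
      intro x
      simp only [insertSupportEquiv, Equiv.coe_fn_mk, map_add, energy_single]
      rw [pow_add, ← pow_mul, mul_comm, mul_comm x.1]
    constructor
    · rw [← (insertSupportEquiv hk).summable_iff]
      refine (Summable.mul_norm hg ih.1).congr fun x => ?_
      rw [Function.comp_apply, e]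
    · rw [← (insertSupportEquiv hk).tsum_eq, tsum_congr e,
        ← tsum_mul_tsum_of_summable_norm hg ih.1, ih.2, Finset.prod_insert hk,
        tsum_geometric_of_norm_lt_one hqk]

lemma prod_one_sub_pow_inv_le {r : ℝ} (hr0 : 0 ≤ r) (hr : r < 1) (s : Finset ℕ+) :
    ∏ k ∈ s, (1 - r ^ (k : ℕ))⁻¹ ≤ Real.exp (∑' n : ℕ, r ^ n / (1 - r)) := by
  have hs : Summable fun n : ℕ => r ^ n / (1 - r) :=
    (summable_geometric_of_lt_one hr0 hr).div_const _
  have hterm : ∀ k : ℕ+, (1 - r ^ (k : ℕ))⁻¹ ≤ Real.exp (r ^ (k : ℕ) / (1 - r)) := by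
    intro k
    have h1 : r ^ (k : ℕ) ≤ r := by
      simpa using pow_le_pow_of_le_one hr0 hr.le (Nat.one_le_iff_ne_zero.mpr k.ne_zero)
    have h0 : 0 ≤ r ^ (k : ℕ) := pow_nonneg hr0 _
    have h2 : (1 - r ^ (k : ℕ))⁻¹ = r ^ (k : ℕ) / (1 - r ^ (k : ℕ)) + 1 := by
      have : 1 - r ^ (k : ℕ) ≠ 0 := by linarith
      field_simp
      ring
    rw [h2]
    refine le_trans ?_ (Real.add_one_le_exp _)
    have : r ^ (k : ℕ) / (1 - r ^ (k : ℕ)) ≤ r ^ (k : ℕ) / (1 - r) :=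
      div_le_div_of_nonneg_left h0 (by linarith) (by linarith)
    linarith
  calc ∏ k ∈ s, (1 - r ^ (k : ℕ))⁻¹ ≤ ∏ k ∈ s, Real.exp (r ^ (k : ℕ) / (1 - r)) := by
        refine Finset.prod_le_prod (fun k _ => ?_) (fun k _ => hterm k)
        have : r ^ (k : ℕ) ≤ 1 := pow_le_one₀ hr0 hr.le
        exact inv_nonneg.mpr (by linarith)
    _ = Real.exp (∑ n ∈ s.map ⟨((↑) : ℕ+ → ℕ), PNat.coe_injective⟩, r ^ n / (1 - r)) := by
        rw [← Real.exp_sum, Finset.sum_map]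
        rfl
    _ ≤ _ := Real.exp_le_exp.mpr (hs.sum_le_tsum _ fun n _ =>
        div_nonneg (pow_nonneg hr0 _) (by linarith))

lemma summable_norm_pow_energy {q : ℂ} (hq : ‖q‖ < 1) :
    Summable (fun d : ℕ+ →₀ ℕ => ‖q ^ energy d‖) := by
  refine summable_of_sum_le (c := Real.exp (∑' n : ℕ, ‖q‖ ^ n / (1 - ‖q‖)))
    (fun d => norm_nonneg _) fun u => ?_
  set s : Finset ℕ+ := u.biUnion Finsupp.support
  have hsub : ∀ d ∈ u, d.support ⊆ s := fun d hd => Finset.subset_biUnion_of_mem _ hd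
  have hq' : ‖((‖q‖ : ℝ) : ℂ)‖ < 1 := by simpa using hq
  obtain ⟨h1, h2⟩ := tsum_pow_energy_support hq' s
  have h3 : ∑' d : {d : ℕ+ →₀ ℕ // d.support ⊆ s}, ‖q‖ ^ energy d.1 =
      ∏ k ∈ s, (1 - ‖q‖ ^ (k : ℕ))⁻¹ := by
    exact_mod_cast h2
  have h1' : Summable fun d : {d : ℕ+ →₀ ℕ // d.support ⊆ s} => ‖q‖ ^ energy d.1 := by
    simpa using h1
  refine le_trans ?_ (prod_one_sub_pow_inv_le (norm_nonneg q) hq s)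
  rw [← h3]
  have h4 : ∑ d ∈ u, ‖q ^ energy d‖ = ∑ d ∈ u.subtype (fun d => d.support ⊆ s),
      ‖q‖ ^ energy d.1 := by
    simp_rw [norm_pow]
    exact (Finset.sum_subtype_of_mem (fun d : ℕ+ →₀ ℕ => ‖q‖ ^ energy d) hsub).symm
  rw [h4]
  exact h1'.sum_le_tsum _ fun d _ => by positivity

/-- Euler's product for the generating function of partitions. -/
lemma tsum_pow_energy {q : ℂ} (hq : ‖q‖ < 1) :
    ∑' d : ℕ+ →₀ ℕ, q ^ energy d = (∏' n : ℕ, (1 - q ^ (n + 1)))⁻¹ := by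
  have hne : ∀ n : ℕ, 1 + -q ^ (n + 1) ≠ 0 := by
    intro n h
    have h1 : q ^ (n + 1) = 1 := by linear_combination -h
    have h2 : ‖q ^ (n + 1)‖ < 1 := by
      rw [norm_pow]; exact pow_lt_one₀ (norm_nonneg _) hq (by simp)
    rw [h1] at h2
    simp at h2
  have hsum : Summable fun n : ℕ => ‖-q ^ (n + 1)‖ := by
    simpa [norm_pow] using
      (summable_nat_add_iff 1).mpr (summable_geometric_of_lt_one (norm_nonneg _) hq)
  have hprod : HasProd (fun n : ℕ => 1 - q ^ (n + 1)) (∏' n : ℕ, (1 - q ^ (n + 1))) := by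
    have := (multipliable_one_add_of_summable hsum).hasProd
    simpa [← sub_eq_add_neg] using this
  have hne' : ∏' n : ℕ, (1 - q ^ (n + 1)) ≠ 0 := by
    have := tprod_one_add_ne_zero_of_summable hne hsum
    simpa [← sub_eq_add_neg] using this
  have hprod' : HasProd (fun k : ℕ+ => 1 - q ^ (k : ℕ)) (∏' n : ℕ, (1 - q ^ (n + 1))) := by
    rw [← Equiv.pnatEquivNat.symm.hasProd_iff]
    simpa [Function.comp_def] using hprod
  have hlim : Tendsto (fun s : Finset ℕ+ => ∏ k ∈ s, (1 - q ^ (k : ℕ))⁻¹) atTop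
      (𝓝 (∏' n : ℕ, (1 - q ^ (n + 1)))⁻¹) := by
    simp only [Finset.prod_inv_distrib]
    exact Tendsto.inv₀ (by simpa [HasProd] using hprod') hne'
  refine tendsto_nhds_unique ?_ hlim
  have hdom := tendsto_tsum_of_dominated_convergence (𝓕 := (atTop : Filter (Finset ℕ+)))
    (f := fun s d => Set.indicator {d : ℕ+ →₀ ℕ | d.support ⊆ s} (fun d => q ^ energy d) d)
    (g := fun d => q ^ energy d) (summable_norm_pow_energy hq) (fun d => ?_)
    (Eventually.of_forall fun s d => norm_indicator_le_norm_self _ _)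
  · refine hdom.congr fun s => ?_
    rw [← (tsum_pow_energy_support hq s).2]
    exact (tsum_subtype {d : ℕ+ →₀ ℕ | d.support ⊆ s} (fun d => q ^ energy d)).symm
  · refine tendsto_const_nhds.congr' ?_
    filter_upwards [eventually_ge_atTop d.support] with s hs
    have hd : d ∈ {d : ℕ+ →₀ ℕ | d.support ⊆ s} := hs
    rw [Set.indicator_of_mem hd]

lemma qpow_add (x y τ : ℂ) : qpow (x + y) τ = qpow x τ * qpow y τ := by
  rw [qpow, qpow, qpow, ← Complex.exp_add]; ring_nf

lemma qpow_ne_zero (x τ : ℂ) : qpow x τ ≠ 0 := Complex.exp_ne_zero _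

lemma qpow_natCast (n : ℕ) (τ : ℂ) : qpow n τ = qpow 1 τ ^ n := by
  rw [qpow, qpow, ← Complex.exp_nat_mul]; ring_nf

lemma norm_qpow_one_lt {τ : ℂ} (hτ : 0 < τ.im) : ‖qpow 1 τ‖ < 1 := by
  rw [qpow, Complex.norm_exp, Real.exp_lt_one_iff]
  have : (2 * Real.pi * I * τ * 1).re = -(2 * Real.pi * τ.im) := by simp
  rw [this]
  have := Real.pi_pos
  have : 0 < 2 * Real.pi * τ.im := by positivity
  linarith

/-- The trace defining a Fock character evaluates to `q ^ ((λ - α₀/2)² / 2) / η`. -/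
theorem fockCh_eq (pp pm : ℕ) (lam : ℂ) {τ : ℂ} (hτ : 0 < τ.im) :
    fockCh pp pm lam τ = qpow ((lam - alphaZero pp pm / 2) ^ 2 / 2) τ / ModularForm.eta τ := by
  set h0 : ℂ := lam * (lam - alphaZero pp pm) / 2 with hh0
  set c : ℂ := (centralCharge pp pm : ℂ) / 24 with hc
  have hq := norm_qpow_one_lt hτ
  -- `finrank` and a constant series both vanish on an infinite fibre, so the finiteness of the
  -- energy levels is not needed here
  have hfib : ∀ h : ℂ, (Module.finrank ℂ (Module.End.eigenspace (fockL0 pp pm lam) h) : ℂ) *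
      qpow (h - centralCharge pp pm / 24) τ =
      ∑' d : ((fun d : ℕ+ →₀ ℕ => h0 + energy d) ⁻¹' {h}),
        qpow (h0 - c) τ * qpow 1 τ ^ energy d.1 := by
    intro h
    rw [finrank_eigenspace_fockL0, ← nsmul_eq_mul, ← tsum_const]
    refine tsum_congr fun d => ?_
    have hd : h0 + energy d.1 = h := d.2
    rw [← qpow_natCast, ← qpow_add]
    congr 1
    linear_combination -hd
  have hsum : HasSum (fun d : ℕ+ →₀ ℕ => qpow (h0 - c) τ * qpow 1 τ ^ energy d)
      (qpow (h0 - c) τ * (∏' n : ℕ, (1 - qpow 1 τ ^ (n + 1)))⁻¹) := by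
    rw [← tsum_pow_energy hq]
    exact ((summable_norm_pow_energy hq).of_norm.hasSum).mul_left _
  have key := (hsum.tsum_fiberwise (fun d : ℕ+ →₀ ℕ => h0 + energy d)).tsum_eq
  rw [fockCh, tsum_congr hfib, key, ModularForm.eta]
  have hprod : ∏' n : ℕ, (1 - ModularForm.eta_q n τ) = ∏' n : ℕ, (1 - qpow 1 τ ^ (n + 1)) := by
    refine tprod_congr fun n => ?_
    rw [ModularForm.eta_q_eq_pow, qpow, mul_one]
  have h24 : Function.Periodic.qParam 24 τ = qpow (1 / 24) τ := by
    rw [Function.Periodic.qParam, qpow]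
    congr 1
    push_cast
    ring
  rw [hprod, h24, div_eq_mul_inv, mul_inv, ← mul_assoc]
  congr 1
  rw [eq_mul_inv_iff_mul_eq₀ (qpow_ne_zero _ _), ← qpow_add]
  congr 1
  rw [hh0, hc, centralCharge]
  push_cast
  ring

/-! ### Gaussian integrals and geometric expansions -/

/-- The regularised character of the Fock module whose weight is `α t / 2 + α₀ / 2`, in the
evaluated form `exp (πεαt) q ^ ((αt/2)² / 2) / η`. -/
def fockTerm (α : ℝ) (ε t τ : ℂ) : ℂ :=
  cexp (Real.pi * ε * α * t) * (qpow ((α * t / 2) ^ 2 / 2) τ / ModularForm.eta τ)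

lemma neg_one_div_im_pos {τ : ℂ} (hτ : 0 < τ.im) : 0 < (-1 / τ).im := by
  have h : τ ≠ 0 := by rintro rfl; simp at hτ
  rw [neg_div, one_div, neg_im, inv_im, neg_div, neg_neg]
  exact div_pos hτ (normSq_pos.mpr h)

/-- The modular inversion of `η`, with the branch of the square root that matches the Gaussian
integral. -/
lemma eta_neg_one_div {τ : ℂ} (hτ : 0 < τ.im) :
    ModularForm.eta (-1 / τ) = (-I * τ) ^ (1 / 2 : ℂ) * ModularForm.eta τ := by
  have h := ModularForm.eta_comp_eq_csqrt_I_inv (show τ ∈ UpperHalfPlane.upperHalfPlaneSet from hτ)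
  have hτ0 : τ ≠ 0 := by rintro rfl; simp at hτ
  simp only [Function.comp_apply, Pi.smul_apply, Pi.mul_apply, smul_eq_mul] at h
  rw [h, ← mul_assoc]
  congr 1
  have hI : sqrt I ≠ 0 := by simp [sqrt]
  rw [inv_mul_eq_iff_eq_mul₀ hI]
  have h1 : -I * τ ≠ 0 := by simp [hτ0]
  have harg : τ.arg ∈ Set.Ioo 0 Real.pi := by
    constructor
    · rcases (arg_nonneg_iff.mpr hτ.le).lt_or_eq with h | h
      · exact h
      · have := arg_eq_zero_iff.mp h.symm
        rw [this.2] at hτ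
        exact absurd hτ (lt_irrefl _)
    · exact arg_lt_pi_iff.mpr (Or.inr hτ.ne')
  have hlog : log (-I * τ) = log τ - log I := by
    have e : -I * τ = cexp (log τ - log I) := by
      rw [Complex.exp_sub, exp_log hτ0, exp_log I_ne_zero, div_I]
      ring
    rw [e, log_exp]
    · rw [sub_im, log_im, log_im, arg_I]
      linarith [harg.1, Real.pi_pos]
    · rw [sub_im, log_im, log_im, arg_I]
      linarith [harg.2, Real.pi_pos]
  rw [sqrt, sqrt, cpow_def_of_ne_zero hτ0, cpow_def_of_ne_zero I_ne_zero, cpow_def_of_ne_zero h1,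
    ← Complex.exp_add, hlog]
  congr 1
  ring

/-- The exponential integrand whose integral is the `S`-transform of `fockTerm`. -/
def fourierTerm (α : ℝ) (ε t τ : ℂ) (x : ℝ) : ℂ :=
  cexp (Real.pi * I * τ * x ^ 2) * cexp (-Real.pi * I * α * t * (x + I * ε))

lemma fourierTerm_eq (α : ℝ) (ε t τ : ℂ) (x : ℝ) : fourierTerm α ε t τ x =
    cexp (Real.pi * I * τ * x ^ 2 + (-Real.pi * I * α * t) * x + Real.pi * ε * α * t) := by
  rw [fourierTerm, ← Complex.exp_add]
  congr 1
  linear_combination (-Real.pi * α * t * ε) * I_sq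

lemma re_pi_I_mul_neg {τ : ℂ} (hτ : 0 < τ.im) : (Real.pi * I * τ).re < 0 := by
  have : (Real.pi * I * τ).re = -(Real.pi * τ.im) := by simp
  rw [this]
  have := Real.pi_pos
  have : 0 < Real.pi * τ.im := by positivity
  linarith

lemma integrable_fourierTerm (α : ℝ) (ε t : ℂ) {τ : ℂ} (hτ : 0 < τ.im) :
    Integrable (fourierTerm α ε t τ) := by
  rw [funext (fourierTerm_eq α ε t τ)]
  exact integrable_cexp_quadratic' (re_pi_I_mul_neg hτ) _ _

/-- The Gaussian is its own Fourier transform; the factor `√(-iτ)` of the Gaussian integral cancels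
against that of `η`. -/
lemma fockTerm_neg_one_div (α : ℝ) (ε t : ℂ) {τ : ℂ} (hτ : 0 < τ.im) :
    fockTerm α ε t (-1 / τ) = (ModularForm.eta τ)⁻¹ * ∫ x : ℝ, fourierTerm α ε t τ x := by
  have hτ0 : τ ≠ 0 := by rintro rfl; simp at hτ
  have hπ : (Real.pi : ℂ) ≠ 0 := by exact_mod_cast Real.pi_ne_zero
  have hre : 0 < (-I * τ).re := by simpa using hτ
  rw [funext (fourierTerm_eq α ε t τ), integral_cexp_quadratic (re_pi_I_mul_neg hτ), fockTerm,
    eta_neg_one_div hτ]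
  have h1 : (Real.pi : ℂ) / -(Real.pi * I * τ) = (-I * τ)⁻¹ := by
    field_simp
  have harg : (-I * τ).arg ≠ Real.pi := by
    rw [Ne, arg_eq_pi_iff]
    rintro ⟨h, -⟩
    exact absurd h (not_lt.mpr hre.le)
  rw [h1, inv_cpow _ _ harg]
  have h2 : cexp (Real.pi * ε * α * t - (-Real.pi * I * α * t) ^ 2 / (4 * (Real.pi * I * τ))) =
      cexp (Real.pi * ε * α * t) * qpow ((α * t / 2) ^ 2 / 2) (-1 / τ) := by
    rw [qpow, ← Complex.exp_add]
    congr 1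
    field_simp
    ring
  rw [h2]
  have h3 := ModularForm.eta_ne_zero (show τ ∈ UpperHalfPlane.upperHalfPlaneSet from hτ)
  have h4 : (-I * τ) ^ (1 / 2 : ℂ) ≠ 0 := by
    rw [Ne, cpow_eq_zero_iff]
    rintro ⟨h, -⟩
    rw [h] at hre
    simp at hre
  field_simp

/-- The signed sum of the four Fock characters with parameters `n - 2K ± a ± b`; it is used with
`a = r / p₊` and `b = s / p₋`. -/
def quadTerm (α : ℝ) (ε a b : ℂ) (n : ℤ) (τ : ℂ) (K : ℤ) : ℂ :=
  fockTerm α ε (n - 2 * K + a + b) τ + fockTerm α ε (n - 2 * K - a - b) τ -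
    fockTerm α ε (n - 2 * K - a + b) τ - fockTerm α ε (n - 2 * K + a - b) τ

/-- The Gaussian numerator of the transformed integrand. -/
def numeratorFun (α : ℝ) (ε a b : ℂ) (n : ℤ) (τ : ℂ) (x : ℝ) : ℂ :=
  cexp (Real.pi * I * τ * x ^ 2) * cexp (-Real.pi * I * n * α * (x + I * ε)) *
    (sin (Real.pi * a * α * (x + I * ε)) * sin (Real.pi * b * α * (x + I * ε)))

/-- The four exponentials combine to a product of two sines, and `K` enters through a power of
`exp (2πiα(x + iε))` only. -/
lemma fourierTerm_quad (α : ℝ) (ε a b : ℂ) (n : ℤ) (τ : ℂ) (K : ℤ) (x : ℝ) :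
    fourierTerm α ε (n - 2 * K + a + b) τ x + fourierTerm α ε (n - 2 * K - a - b) τ x -
      fourierTerm α ε (n - 2 * K - a + b) τ x - fourierTerm α ε (n - 2 * K + a - b) τ x =
    -4 * numeratorFun α ε a b n τ x * cexp (2 * Real.pi * I * α * (x + I * ε)) ^ K := by
  rw [← Complex.exp_int_mul]
  set z : ℂ := x + I * ε
  have key : ∀ s t : ℂ, cexp (-Real.pi * I * α * (n - 2 * K + s + t) * z) =
      cexp (-Real.pi * I * n * α * z) * cexp (K * (2 * Real.pi * I * α * z)) *
        (cexp (-(Real.pi * α * z * s) * I) * cexp (-(Real.pi * α * z * t) * I)) := by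
    intro s t
    rw [← Complex.exp_add, ← Complex.exp_add, ← Complex.exp_add]
    ring_nf
  have k1 := key a b
  have k2 := key (-a) (-b)
  have k3 := key (-a) b
  have k4 := key a (-b)
  simp only [fourierTerm, numeratorFun, Complex.sin]
  rw [show (n - 2 * K - a - b : ℂ) = n - 2 * K + -a + -b by ring,
    show (n - 2 * K - a + b : ℂ) = n - 2 * K + -a + b by ring,
    show (n - 2 * K + a - b : ℂ) = n - 2 * K + a + -b by ring, k1, k2, k3, k4,
    show Real.pi * α * z * a = Real.pi * a * α * z by ring,
    show Real.pi * α * z * b = Real.pi * b * α * z by ring,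
    show Real.pi * α * z * -a = -(Real.pi * a * α * z) by ring,
    show Real.pi * α * z * -b = -(Real.pi * b * α * z) by ring]
  simp only [neg_neg]
  generalize cexp (-(Real.pi * a * α * z) * I) = A
  generalize cexp (Real.pi * a * α * z * I) = A'
  generalize cexp (-(Real.pi * b * α * z) * I) = B
  generalize cexp (Real.pi * b * α * z * I) = B'
  linear_combination (cexp (Real.pi * I * τ * x ^ 2) * cexp (-Real.pi * I * n * α * z) *
    cexp (K * (2 * Real.pi * I * α * z)) * (A - A') * (B - B')) * I_sq

lemma integrable_numeratorFun_mul_zpow (α : ℝ) (ε a b : ℂ) (n : ℤ) {τ : ℂ} (hτ : 0 < τ.im)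
    (K : ℤ) : Integrable fun x : ℝ =>
      -4 * numeratorFun α ε a b n τ x * cexp (2 * Real.pi * I * α * (x + I * ε)) ^ K := by
  simp_rw [← fourierTerm_quad]
  exact (((integrable_fourierTerm _ _ _ hτ).add (integrable_fourierTerm _ _ _ hτ)).sub
    (integrable_fourierTerm _ _ _ hτ)).sub (integrable_fourierTerm _ _ _ hτ)

lemma quadTerm_neg_one_div (α : ℝ) (ε a b : ℂ) (n : ℤ) {τ : ℂ} (hτ : 0 < τ.im) (K : ℤ) :
    quadTerm α ε a b n (-1 / τ) K = (ModularForm.eta τ)⁻¹ * ∫ x : ℝ,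
      -4 * numeratorFun α ε a b n τ x * cexp (2 * Real.pi * I * α * (x + I * ε)) ^ K := by
  simp_rw [← fourierTerm_quad]
  have i := fun t => integrable_fourierTerm α ε t hτ
  rw [integral_sub (by exact ((i _).add (i _)).sub (i _)) (i _),
    integral_sub (by exact (i _).add (i _)) (i _), integral_add (i _) (i _), quadTerm]
  simp only [fockTerm_neg_one_div α ε _ hτ]
  ring

lemma norm_cexp_two_pi_I_mul (α : ℝ) (ε : ℂ) (x : ℝ) :
    ‖cexp (2 * Real.pi * I * α * (x + I * ε))‖ = Real.exp (-(2 * Real.pi * α * ε.re)) := by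
  rw [Complex.norm_exp]
  congr 1
  simp
  
/-- The expansion `1 / sin² w = -4 ∑ j e^{2ijσw}`, valid in the half-plane where `e^{2iσw}` is
small. -/
lemma hasSum_inv_sin_sq {w : ℂ} {σ : ℤ} (hσ : σ = 1 ∨ σ = -1) (hw : ‖cexp (2 * I * w) ^ σ‖ < 1) :
    HasSum (fun j : ℕ => -4 * (j * cexp (2 * I * w) ^ (σ * j))) (1 / sin w ^ 2) := by
  have h := (hasSum_coe_mul_geometric_of_norm_lt_one hw).mul_left (-4)
  have e : ∀ j : ℕ, cexp (2 * I * w) ^ (σ * j) = (cexp (2 * I * w) ^ σ) ^ j := by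
    intro j
    rw [zpow_mul, zpow_natCast]
  simp_rw [e]
  convert! h using 1
  have h0 := Complex.exp_ne_zero (w * I)
  have hs : sin w = (cexp (w * I) ^ 2 - 1) / cexp (w * I) * (-I / 2) := by
    rw [Complex.sin, neg_mul, Complex.exp_neg]
    field_simp
    ring
  have hy : cexp (2 * I * w) = cexp (w * I) ^ 2 := by
    rw [← Complex.exp_nat_mul]
    congr 1
    push_cast
    ring
  rw [hs, hy]
  rw [hy] at hw
  generalize cexp (w * I) = v at h0 hw
  have hv : v ^ 2 - 1 ≠ 0 := by
    intro hv
    rw [sub_eq_zero.mp hv] at hw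
    simp at hw
  have hv' : 1 - v ^ 2 ≠ 0 := by
    intro h'
    exact hv (by linear_combination -h')
  rcases hσ with rfl | rfl
  · rw [zpow_one]
    rw [show (v ^ 2 - 1) / v * (-I / 2) = (1 - v ^ 2) / v * (I / 2) by ring, mul_pow, div_pow,
      div_pow, I_sq]
    field_simp
    norm_num
  · rw [zpow_neg_one, show (1 : ℂ) - (v ^ 2)⁻¹ = (v ^ 2 - 1) / v ^ 2 by field_simp, mul_pow,
      div_pow, div_pow, div_pow, neg_sq, I_sq]
    field_simp
    norm_num

/-- Termwise integration of the expansion of `1 / sin²`. The sign `σ` is that of `α Re ε`: the ratio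
of the geometric expansion has a modulus `ρ < 1` that does not depend on `x`, which dominates both
the integrand and the series. -/
lemma hasSum_quadTerm {α : ℝ} {ε : ℂ} {σ : ℤ} (hσ : σ = 1 ∨ σ = -1) (hα : 0 < σ * (α * ε.re))
    (a b : ℂ) (n : ℤ) {τ : ℂ} (hτ : 0 < τ.im) :
    Integrable (fun x : ℝ => (ModularForm.eta τ)⁻¹ *
      (numeratorFun α ε a b n τ x / sin (Real.pi * α * (x + I * ε)) ^ 2)) ∧
    HasSum (fun j : ℕ => (j : ℂ) * quadTerm α ε a b n (-1 / τ) (σ * j))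
      (∫ x : ℝ, (ModularForm.eta τ)⁻¹ *
        (numeratorFun α ε a b n τ x / sin (Real.pi * α * (x + I * ε)) ^ 2)) := by
  set H := numeratorFun α ε a b n τ
  set y : ℝ → ℂ := fun x => cexp (2 * Real.pi * I * α * (x + I * ε)) with hy
  -- the modulus of `y x ^ σ`
  set ρ : ℝ := Real.exp (-(2 * Real.pi * α * ε.re)) ^ σ with hρ
  have hρ0 : 0 ≤ ρ := zpow_nonneg (Real.exp_pos _).le _
  have hρ1 : ρ < 1 := by
    have := mul_pos Real.pi_pos hα
    rcases hσ with rfl | rfl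
    · rw [hρ, zpow_one, Real.exp_lt_one_iff]
      push_cast at this
      linarith
    · rw [hρ, zpow_neg_one, ← Real.exp_neg, Real.exp_lt_one_iff]
      push_cast at this
      linarith
  have hnorm : ∀ (x : ℝ) (j : ℕ), ‖y x ^ (σ * j)‖ = ρ ^ j := by
    intro x j
    rw [zpow_mul, zpow_natCast, norm_pow, norm_zpow, hy, norm_cexp_two_pi_I_mul]
  have hHint : Integrable H := by
    have := (integrable_numeratorFun_mul_zpow α ε a b n hτ 0).const_mul (-1 / 4)
    refine this.congr (Eventually.of_forall fun x => ?_)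
    simp only [zpow_zero]
    ring
  have hgeo : Summable fun j : ℕ => (j : ℝ) * ρ ^ j :=
    (hasSum_coe_mul_geometric_of_norm_lt_one (r := ρ)
      (by rwa [Real.norm_of_nonneg hρ0])).summable
  have hexp : ∀ x, HasSum (fun j : ℕ => -4 * ((j : ℂ) * y x ^ (σ * j)))
      (1 / sin (Real.pi * α * (x + I * ε)) ^ 2) := by
    intro x
    have e : y x = cexp (2 * I * (Real.pi * α * (x + I * ε))) := by
      rw [hy]; ring_nf
    rw [e]
    refine hasSum_inv_sin_sq hσ ?_
    rw [← e]
    simpa using (hnorm x 1).trans_lt (by simpa using hρ1)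
  have hF : ∀ j : ℕ, Integrable fun x => (j : ℂ) * (-4 * H x * y x ^ (σ * j)) := fun j =>
    (integrable_numeratorFun_mul_zpow α ε a b n hτ (σ * j)).const_mul _
  have hFnorm : ∀ j : ℕ, ∫ x, ‖(j : ℂ) * (-4 * H x * y x ^ (σ * j))‖ =
      (j * ρ ^ j) * (4 * ∫ x, ‖H x‖) := by
    intro j
    rw [← integral_const_mul, ← integral_const_mul]
    congr 1
    funext x
    simp only [norm_mul, hnorm, Complex.norm_natCast, norm_neg, Complex.norm_ofNat]
    ring
  have hsum := hasSum_integral_of_summable_integral_norm hF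
    (by simp_rw [hFnorm]; exact hgeo.mul_right _)
  have htsum : ∀ x, ∑' j : ℕ, (j : ℂ) * (-4 * H x * y x ^ (σ * j)) =
      H x / sin (Real.pi * α * (x + I * ε)) ^ 2 := by
    intro x
    rw [div_eq_mul_one_div, ← ((hexp x).mul_left (H x)).tsum_eq]
    exact tsum_congr fun j => by ring
  simp_rw [htsum] at hsum
  constructor
  · refine Integrable.const_mul ?_ _
    have hmeas : AEStronglyMeasurable (fun x : ℝ => 1 / sin (Real.pi * α * (x + I * ε)) ^ 2) := by
      refine Measurable.aestronglyMeasurable ?_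
      simp_rw [one_div]
      exact Measurable.inv (Continuous.measurable (by fun_prop))
    refine (hHint.bdd_mul hmeas (c := 4 * ∑' j : ℕ, (j : ℝ) * ρ ^ j)
      (Eventually.of_forall fun x => ?_)).congr (Eventually.of_forall fun x => ?_)
    · rw [← (hexp x).tsum_eq, ← tsum_mul_left]
      refine tsum_of_norm_bounded (hgeo.mul_left 4).hasSum fun j => le_of_eq ?_
      simp only [norm_mul, hnorm, Complex.norm_natCast, norm_neg, Complex.norm_ofNat]
    · ring
  · rw [integral_const_mul]
    convert! hsum.mul_left (ModularForm.eta τ)⁻¹ using 2 with j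
    rw [quadTerm_neg_one_div α ε a b n hτ, integral_const_mul]
    ring

/-! ### Characters of singlet modules as a single weighted series -/

lemma alphaFull_sq (pp pm : ℕ) : alphaFull pp pm ^ 2 = 2 * pp * pm :=
  Real.sq_sqrt (by positivity)

lemma alphaFull_pos {pp pm : ℕ} (hpp : 1 ≤ pp) (hpm : 1 ≤ pm) : 0 < alphaFull pp pm := by
  have h1 : (0 : ℝ) < pp := by exact_mod_cast hpp
  have h2 : (0 : ℝ) < pm := by exact_mod_cast hpm
  exact Real.sqrt_pos.mpr (by positivity)

lemma alphaPlus_eq {pp : ℕ} (pm : ℕ) (hpp : 1 ≤ pp) :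
    alphaPlus pp pm = alphaFull pp pm / pp := by
  have h1 : (0 : ℝ) < pp := by exact_mod_cast hpp
  rw [alphaPlus, alphaFull, eq_div_iff h1.ne', ← Real.sqrt_sq h1.le,
    ← Real.sqrt_mul (by positivity), Real.sqrt_sq h1.le]
  congr 1
  field_simp

lemma alphaMinus_eq (pp : ℕ) {pm : ℕ} (hpm : 1 ≤ pm) :
    alphaMinus pp pm = -(alphaFull pp pm / pm) := by
  have h1 : (0 : ℝ) < pm := by exact_mod_cast hpm
  rw [alphaMinus, alphaFull, neg_inj, eq_div_iff h1.ne', ← Real.sqrt_sq h1.le,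
    ← Real.sqrt_mul (by positivity), Real.sqrt_sq h1.le]
  congr 1
  field_simp

/-- The weight `α_{r,s;n}` relative to its symmetry point `α₀ / 2`. -/
lemma alphaRSN_sub {pp pm : ℕ} (hpp : 1 ≤ pp) (hpm : 1 ≤ pm) (r s n : ℤ) :
    (alphaRSN pp pm r s n : ℂ) - alphaZero pp pm / 2 =
      alphaFull pp pm * (n - r / pp + s / pm) / 2 := by
  rw [alphaRSN, alphaZero, alphaPlus_eq pm hpp, alphaMinus_eq pp hpm]
  push_cast
  ring

lemma regFFCh_eq {pp pm : ℕ} (hpp : 1 ≤ pp) (hpm : 1 ≤ pm) (ε : ℂ) (r s n : ℤ) {τ : ℂ}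
    (hτ : 0 < τ.im) : regFFCh pp pm ε r s n τ =
      fockTerm (alphaFull pp pm) ε (n - r / pp + s / pm) τ := by
  rw [regFFCh, regFockCh, fockCh_eq _ _ _ hτ, alphaRSN_sub hpp hpm, fockTerm]
  congr 2
  ring

/-- The factors `exp (∓2πεx)` cancel, so the integrand is a Gaussian numerator over a squared
sine. -/
lemma kernelS_mul_regFockCh {pp pm : ℕ} (hpp : 1 ≤ pp) (hpm : 1 ≤ pm) (ε : ℂ) (r s n : ℤ) {τ : ℂ}
    (hτ : 0 < τ.im) (x : ℝ) :
    kernelS pp pm ε r s n x * regFockCh pp pm ε (x + alphaZero pp pm / 2) τ =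
      (ModularForm.eta τ)⁻¹ * (numeratorFun (alphaFull pp pm) ε (r / pp) (s / pm) n τ x /
        sin (Real.pi * alphaFull pp pm * (x + I * ε)) ^ 2) := by
  have hα : (alphaFull pp pm : ℂ) ≠ 0 := by exact_mod_cast (alphaFull_pos hpp hpm).ne'
  have hα2 : (alphaFull pp pm : ℂ) ^ 2 = 2 * pp * pm := by exact_mod_cast alphaFull_sq pp pm
  have h1 : (pp : ℂ) ≠ 0 := by exact_mod_cast (by omega : pp ≠ 0)
  have h2 : (pm : ℂ) ≠ 0 := by exact_mod_cast (by omega : pm ≠ 0)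
  rw [regFockCh, fockCh_eq _ _ _ hτ, kernelS, numeratorFun, add_sub_cancel_right, qpow]
  have e1 : 2 * Real.pi * r * pm * ((x + I * ε) / alphaFull pp pm) =
      Real.pi * (r / pp) * alphaFull pp pm * (x + I * ε) := by
    field_simp
    linear_combination (-(r : ℂ) * (x + I * ε)) * hα2
  have e2 : 2 * Real.pi * s * pp * ((x + I * ε) / alphaFull pp pm) =
      Real.pi * (s / pm) * alphaFull pp pm * (x + I * ε) := by
    field_simp
    linear_combination (-(s : ℂ) * (x + I * ε)) * hα2
  have e3 : cexp (-2 * Real.pi * ε * x) * cexp (2 * Real.pi * ε * x) = 1 := by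
    rw [← Complex.exp_add, ← Complex.exp_zero]
    congr 1
    ring
  have e4 : cexp (2 * Real.pi * I * τ * ((x : ℂ) ^ 2 / 2)) = cexp (Real.pi * I * τ * x ^ 2) := by
    congr 1
    ring
  rw [e1, e2, e4]
  simp only [div_eq_mul_inv]
  linear_combination (cexp (-Real.pi * I * n * alphaFull pp pm * (x + I * ε)) *
    (sin (Real.pi * (r * (pp : ℂ)⁻¹) * alphaFull pp pm * (x + I * ε)) *
      sin (Real.pi * (s * (pm : ℂ)⁻¹) * alphaFull pp pm * (x + I * ε))) *
    (sin (Real.pi * alphaFull pp pm * (x + I * ε)) ^ 2)⁻¹ * cexp (Real.pi * I * τ * x ^ 2) *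
    (ModularForm.eta τ)⁻¹) * e3

/-- Along a coset of weights the Fock characters are the terms of a Jacobi theta series. -/
lemma fockTerm_eq_jacobiTheta₂_term (α : ℝ) (ε c τ : ℂ) (K : ℤ) :
    fockTerm α ε (c - 2 * K) τ =
      cexp (Real.pi * ε * α * c) * cexp (Real.pi * I * τ * α ^ 2 * c ^ 2 / 4) / ModularForm.eta τ *
        jacobiTheta₂_term K (I * ε * α - τ * α ^ 2 * c / 2) (α ^ 2 * τ) := by
  rw [fockTerm, jacobiTheta₂_term, qpow, ← mul_div_assoc, div_mul_eq_mul_div, ← Complex.exp_add,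
    ← Complex.exp_add, ← Complex.exp_add]
  congr 2
  linear_combination (-2 * Real.pi * K * ε * α) * I_sq

lemma im_sq_mul_pos {α : ℝ} (hα : 0 < α) {τ : ℂ} (hτ : 0 < τ.im) : 0 < ((α : ℂ) ^ 2 * τ).im := by
  rw [← ofReal_pow, im_ofReal_mul]
  positivity

lemma summable_fockTerm {α : ℝ} (hα : 0 < α) (ε c : ℂ) {τ : ℂ} (hτ : 0 < τ.im) :
    Summable fun K : ℤ => fockTerm α ε (c - 2 * K) τ := by
  simp_rw [fockTerm_eq_jacobiTheta₂_term]
  exact ((summable_jacobiTheta₂_term_iff _ _).mpr (im_sq_mul_pos hα hτ)).mul_left _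

lemma summable_mul_fockTerm {α : ℝ} (hα : 0 < α) (ε c : ℂ) {τ : ℂ} (hτ : 0 < τ.im) :
    Summable fun K : ℤ => (K : ℂ) * fockTerm α ε (c - 2 * K) τ := by
  have h := ((summable_jacobiTheta₂'_term_iff (I * ε * α - τ * α ^ 2 * c / 2) _).mpr
    (im_sq_mul_pos hα hτ)).mul_left
      (cexp (Real.pi * ε * α * c) * cexp (Real.pi * I * τ * α ^ 2 * c ^ 2 / 4) /
        ModularForm.eta τ / (2 * Real.pi * I))
  refine h.congr fun K => ?_
  rw [fockTerm_eq_jacobiTheta₂_term, jacobiTheta₂'_term]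
  have : (2 * Real.pi * I : ℂ) ≠ 0 := two_pi_I_ne_zero
  field_simp

lemma quadTerm_eq (α : ℝ) (ε a b : ℂ) (n : ℤ) (τ : ℂ) (K : ℤ) : quadTerm α ε a b n τ K =
    fockTerm α ε (n + a + b - 2 * K) τ + fockTerm α ε (n - a - b - 2 * K) τ -
      fockTerm α ε (n - a + b - 2 * K) τ - fockTerm α ε (n + a - b - 2 * K) τ := by
  rw [quadTerm]
  ring_nf

lemma summable_mul_quadTerm {α : ℝ} (hα : 0 < α) (ε a b : ℂ) (n : ℤ) {τ : ℂ} (hτ : 0 < τ.im) :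
    Summable fun K : ℤ => (K : ℂ) * quadTerm α ε a b n τ K := by
  have h := fun c => summable_mul_fockTerm hα ε c hτ
  refine ((((h (n + a + b)).add (h (n - a - b))).sub (h (n - a + b))).sub (h (n + a - b))).congr
    fun K => ?_
  rw [quadTerm_eq]
  ring

/-- Abel summation: `∑ j (g_j - g_{j+1}) = ∑ g_{j+1}`. -/
lemma hasSum_mul_sub_succ {g : ℕ → ℂ} (hg : Summable fun j : ℕ => (j : ℂ) * g j) :
    Summable (fun j => g (j + 1)) ∧
      HasSum (fun j : ℕ => (j : ℂ) * (g j - g (j + 1))) (∑' j, g (j + 1)) := by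
  have h1 : Summable fun j : ℕ => ((j + 1 : ℕ) : ℂ) * g (j + 1) := (summable_nat_add_iff 1).mpr hg
  have h2 : Summable fun j => g (j + 1) := by
    refine Summable.of_norm_bounded h1.norm fun j => ?_
    rw [norm_mul, Complex.norm_natCast]
    refine le_mul_of_one_le_left (norm_nonneg _) ?_
    push_cast
    linarith [(Nat.cast_nonneg j : (0 : ℝ) ≤ j)]
  refine ⟨h2, ?_⟩
  have h3 : ∑' j : ℕ, (j : ℂ) * g j = ∑' j : ℕ, ((j + 1 : ℕ) : ℂ) * g (j + 1) := by
    rw [hg.tsum_eq_zero_add]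
    simp
  have h4 := (hg.hasSum.sub h1.hasSum).add h2.hasSum
  rw [h3, sub_self, zero_add] at h4
  convert! h4 using 2 with j
  push_cast
  ring

lemma summable_nat_mul_fockTerm {α : ℝ} (hα : 0 < α) (ε c : ℂ) {τ : ℂ} (hτ : 0 < τ.im) :
    Summable fun j : ℕ => (j : ℂ) * fockTerm α ε (c - 2 * j) τ := by
  have := (summable_mul_fockTerm hα ε c hτ).comp_injective Nat.cast_injective
  simpa [Function.comp_def] using this

/-- When `b = 1`, which is the border `s = p₋`, the weighted series telescopes. -/
lemma hasSum_quadTerm_one {α : ℝ} (hα : 0 < α) (ε a : ℂ) (n : ℤ) {τ : ℂ} (hτ : 0 < τ.im) :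
    HasSum (fun j : ℕ => (j : ℂ) * quadTerm α ε a 1 n τ j)
      (∑' j : ℕ, (fockTerm α ε (n - 2 * j - 1 + a) τ - fockTerm α ε (n - 2 * j - 1 - a) τ)) := by
  have h := (hasSum_mul_sub_succ (g := fun j : ℕ => fockTerm α ε (n + 1 + a - 2 * j) τ -
    fockTerm α ε (n + 1 - a - 2 * j) τ) (by
      refine ((summable_nat_mul_fockTerm hα ε (n + 1 + a) hτ).sub
        (summable_nat_mul_fockTerm hα ε (n + 1 - a) hτ)).congr fun j => ?_
      ring)).2
  convert! h using 2 with j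
  · rw [quadTerm]
    push_cast
    ring_nf
  · funext j
    push_cast
    ring_nf

lemma quadTerm_comm (α : ℝ) (ε a b : ℂ) (n : ℤ) (τ : ℂ) (K : ℤ) :
    quadTerm α ε a b n τ K = quadTerm α ε b a n τ K := by
  rw [quadTerm, quadTerm]
  ring_nf

/-- A second telescoping, at the corner `r = p₊`, `s = p₋`. -/
lemma tsum_fockTerm_sub {α : ℝ} (hα : 0 < α) (ε : ℂ) (n : ℤ) {τ : ℂ} (hτ : 0 < τ.im) :
    ∑' j : ℕ, (fockTerm α ε (n - 2 * j - 1 + 1) τ - fockTerm α ε (n - 2 * j - 1 - 1) τ) =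
      fockTerm α ε n τ := by
  have h : Summable fun j : ℕ => fockTerm α ε (n - 2 * j) τ := by
    have := (summable_fockTerm hα ε n hτ).comp_injective Nat.cast_injective
    simpa [Function.comp_def] using this
  have h1 := (h.hasSum.sub ((summable_nat_add_iff 1).mpr h).hasSum)
  have h2 := h.tsum_eq_zero_add
  have h3 : ∑' j : ℕ, fockTerm α ε (n - 2 * j) τ -
      ∑' j : ℕ, fockTerm α ε (n - 2 * (j + 1 : ℕ)) τ = fockTerm α ε n τ := by
    rw [h2]
    simp
  rw [h3] at h1
  rw [← h1.tsum_eq]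
  refine tsum_congr fun j => ?_
  push_cast
  ring_nf

/-- The part of the singlet character that is a multiple of a minimal model character; it is absent
on the border of the Kac table. -/
def virPart (pp pm : ℕ) (r s n : ℤ) (τ : ℂ) : ℂ :=
  if r = pp ∨ s = pm then 0 else if 0 ≤ n then
    (n : ℂ) * (if Even n then virCh pp pm r s τ else -virCh pp pm r (pm - s) τ) else 0

/-- The four cases of the definition of the singlet characters share one weighted series. -/
theorem regICh_eq {pp pm : ℕ} (hpp : 1 ≤ pp) (hpm : 1 ≤ pm) (ε : ℂ) (r s n : ℤ) {τ : ℂ}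
    (hτ : 0 < τ.im) : regICh pp pm ε r s n τ = virPart pp pm r s n τ +
      ∑' j : ℕ, (j : ℂ) * quadTerm (alphaFull pp pm) ε (r / pp) (s / pm) n τ j := by
  have hα := alphaFull_pos hpp hpm
  have h1 : (pp : ℂ) ≠ 0 := by exact_mod_cast (by omega : pp ≠ 0)
  have h2 : (pm : ℂ) ≠ 0 := by exact_mod_cast (by omega : pm ≠ 0)
  rw [regICh, virPart]
  by_cases hr : r = pp
  · subst hr
    by_cases hs : s = pm
    · subst hs
      simp only [and_self, if_true, or_self, zero_add, Int.cast_natCast, div_self h1, div_self h2]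
      rw [(hasSum_quadTerm_one hα ε 1 n hτ).tsum_eq, tsum_fockTerm_sub hα ε n hτ,
        regFFCh_eq hpp hpm _ _ _ _ hτ]
      simp [div_self h1, div_self h2]
    · simp only [hs, and_false, if_false, if_true, true_or, zero_add, Int.cast_natCast, div_self h1,
        regIMinusCh, ne_eq, not_true_eq_false, false_and]
      simp_rw [quadTerm_comm _ _ (1 : ℂ)]
      rw [(hasSum_quadTerm_one hα ε _ n hτ).tsum_eq]
      refine tsum_congr fun j => ?_
      simp only [regFFCh_eq hpp hpm _ _ _ _ hτ]
      push_cast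
      rw [div_self h1, sub_div, div_self h2]
      ring_nf
  · by_cases hs : s = pm
    · subst hs
      simp only [hr, false_and, if_false, if_true, or_true, zero_add, Int.cast_natCast, div_self h2,
        regIPlusCh, ne_eq, not_true_eq_false]
      rw [(hasSum_quadTerm_one hα ε _ n hτ).tsum_eq]
      refine tsum_congr fun j => ?_
      simp only [regFFCh_eq hpp hpm _ _ _ _ hτ]
      push_cast
      rw [div_self h2, sub_div, div_self h1]
      ring_nf
    · simp only [hr, hs, and_self, if_false, or_self]
      congr 1
      have hsum : Summable fun j : ℕ => (j : ℂ) *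
          quadTerm (alphaFull pp pm) ε (r / pp) (s / pm) n τ j := by
        have := (summable_mul_quadTerm hα ε (r / pp) (s / pm) n hτ).comp_injective
          Nat.cast_injective
        simpa [Function.comp_def] using this
      rw [hsum.tsum_eq_zero_add]
      simp only [Nat.cast_zero, zero_mul, zero_add]
      refine tsum_congr fun j => ?_
      simp only [regFFCh_eq hpp hpm _ _ _ _ hτ, quadTerm]
      push_cast
      rw [sub_div, sub_div, div_self h2, div_self h1]
      ring_nf

/-! ### Poisson summation and the correction term -/

/-- The function `η⁻¹ ∑_M e^{πiMc} q^{(M/α + iε)²/2}` of `ε`. -/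
def thetaChar (α : ℝ) (c τ ε : ℂ) : ℂ :=
  (ModularForm.eta τ)⁻¹ *
    (qpow (-ε ^ 2 / 2) τ * jacobiTheta₂ (c / 2 + I * ε * τ / α) (τ / α ^ 2))

lemma im_div_sq_pos {α : ℝ} (hα : 0 < α) {τ : ℂ} (hτ : 0 < τ.im) : 0 < (τ / (α : ℂ) ^ 2).im := by
  rw [← ofReal_pow, div_ofReal_im]
  positivity

lemma hasDerivAt_thetaChar {α : ℝ} (hα : 0 < α) (c : ℂ) {τ : ℂ} (hτ : 0 < τ.im) (ε : ℂ) :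
    HasDerivAt (thetaChar α c τ)
      ((ModularForm.eta τ)⁻¹ * (qpow (-ε ^ 2 / 2) τ *
        (I * τ / α * jacobiTheta₂' (c / 2 + I * ε * τ / α) (τ / α ^ 2) -
          2 * Real.pi * I * τ * ε * jacobiTheta₂ (c / 2 + I * ε * τ / α) (τ / α ^ 2)))) ε := by
  have h1 : HasDerivAt (fun e : ℂ => c / 2 + I * e * τ / α) (I * τ / α) ε := by
    have := ((((hasDerivAt_id ε).const_mul I).mul_const τ).div_const (α : ℂ)).const_add (c / 2)
    simpa using this
  have h2 := (hasDerivAt_jacobiTheta₂_fst (c / 2 + I * ε * τ / α) (im_div_sq_pos hα hτ)).comp ε h1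
  have h3 : HasDerivAt (fun e : ℂ => qpow (-e ^ 2 / 2) τ)
      (qpow (-ε ^ 2 / 2) τ * (-(2 * Real.pi * I * τ * ε))) ε := by
    have h4 : HasDerivAt (fun e : ℂ => 2 * Real.pi * I * τ * (-e ^ 2 / 2))
        (-(2 * Real.pi * I * τ * ε)) ε := by
      have := (((hasDerivAt_pow 2 ε).neg).div_const 2).const_mul (2 * Real.pi * I * τ)
      convert! this using 1
      simp
      ring
    exact h4.cexp
  refine ((h3.mul h2).const_mul (ModularForm.eta τ)⁻¹).congr_deriv ?_
  simp only [Function.comp_apply]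
  ring

lemma sq_mul_cpow_half {α : ℝ} (hα : 0 < α) {w : ℂ} (hw : w ≠ 0) :
    (((α ^ 2 : ℝ) : ℂ) * w) ^ (1 / 2 : ℂ) = α * w ^ (1 / 2 : ℂ) := by
  have h1 : ((α ^ 2 : ℝ) : ℂ) * w ≠ 0 := mul_ne_zero (by exact_mod_cast (pow_pos hα 2).ne') hw
  rw [cpow_def_of_ne_zero h1, cpow_def_of_ne_zero hw, log_ofReal_mul (by positivity) hw,
    Real.log_pow, add_mul, Complex.exp_add]
  congr 1
  rw [show (((2 : ℕ) * Real.log α : ℝ) : ℂ) * (1 / 2) = (Real.log α : ℂ) by push_cast; ring,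
    ← ofReal_exp, Real.exp_log hα]

lemma neg_I_mul_cpow_half {α : ℝ} (hα : 0 < α) {τ : ℂ} (hτ : 0 < τ.im) :
    (-I * (α ^ 2 * (-1 / τ))) ^ (1 / 2 : ℂ) = α * ((-I * τ) ^ (1 / 2 : ℂ))⁻¹ := by
  have hτ0 : τ ≠ 0 := by rintro rfl; simp at hτ
  have hre : 0 < (-I * τ).re := by simpa using hτ
  have harg : (-I * τ).arg ≠ Real.pi := by
    rw [Ne, arg_eq_pi_iff]
    rintro ⟨h, -⟩
    exact absurd h (not_lt.mpr hre.le)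
  have : -I * (α ^ 2 * (-1 / τ)) = ((α ^ 2 : ℝ) : ℂ) * (-I * τ)⁻¹ := by
    push_cast
    field_simp
    linear_combination (α : ℂ) ^ 2 * I_sq
  rw [this, ← inv_cpow _ _ harg]
  exact sq_mul_cpow_half hα (inv_ne_zero (by simp [hτ0]))

/-- The first moment of the Fock characters over a full coset, transformed by `τ ↦ -1/τ`. The
functional equation of `jacobiTheta₂'` produces a theta value and its derivative; the derivative is
rewritten as a derivative in `ε`. -/
lemma tsum_mul_fockTerm {α : ℝ} (hα : 0 < α) (ε c : ℂ) {τ : ℂ} (hτ : 0 < τ.im) :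
    ∑' K : ℤ, (K : ℂ) * fockTerm α ε (c - 2 * K) (-1 / τ) =
      -1 / (2 * Real.pi * α ^ 2) * deriv (thetaChar α c τ) ε +
        c / (2 * α) * thetaChar α c τ ε := by
  have hτ0 : τ ≠ 0 := by rintro rfl; simp at hτ
  have hα0 : (α : ℂ) ≠ 0 := by exact_mod_cast hα.ne'
  have hπ : (Real.pi : ℂ) ≠ 0 := by exact_mod_cast Real.pi_ne_zero
  have heta := ModularForm.eta_ne_zero (show τ ∈ UpperHalfPlane.upperHalfPlaneSet from hτ)
  have hκ : (-I * τ) ^ (1 / 2 : ℂ) ≠ 0 := by simp [cpow_eq_zero_iff, hτ0]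
  set z1 : ℂ := I * ε * α - -1 / τ * α ^ 2 * c / 2 with hz1
  set τ1 : ℂ := α ^ 2 * (-1 / τ) with hτ1
  set z : ℂ := c / 2 + I * ε * τ / α with hz
  have e1 : z1 / τ1 = -z := by
    rw [hz1, hτ1, hz]
    field_simp
    ring
  have e2 : -1 / τ1 = τ / α ^ 2 := by
    rw [hτ1]
    field_simp
  have e3 : (-I * τ1) ^ (1 / 2 : ℂ) = α * ((-I * τ) ^ (1 / 2 : ℂ))⁻¹ := neg_I_mul_cpow_half hα hτ
  have h0 : ∑' K : ℤ, (K : ℂ) * fockTerm α ε (c - 2 * K) (-1 / τ) =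
      cexp (Real.pi * ε * α * c) * cexp (Real.pi * I * (-1 / τ) * α ^ 2 * c ^ 2 / 4) /
        ModularForm.eta (-1 / τ) / (2 * Real.pi * I) * jacobiTheta₂' z1 τ1 := by
    rw [jacobiTheta₂', ← tsum_mul_left]
    refine tsum_congr fun K => ?_
    rw [fockTerm_eq_jacobiTheta₂_term, jacobiTheta₂'_term, ← hz1, ← hτ1]
    have : (2 * Real.pi * I : ℂ) ≠ 0 := two_pi_I_ne_zero
    generalize jacobiTheta₂_term K z1 τ1 = J
    generalize cexp (Real.pi * ε * α * c) * cexp (Real.pi * I * (-1 / τ) * α ^ 2 * c ^ 2 / 4) /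
      ModularForm.eta (-1 / τ) = A
    field_simp
  have e4 : cexp (Real.pi * ε * α * c) * cexp (Real.pi * I * (-1 / τ) * α ^ 2 * c ^ 2 / 4) *
      cexp (-Real.pi * I * z1 ^ 2 / τ1) = qpow (-ε ^ 2 / 2) τ := by
    rw [qpow, ← Complex.exp_add, ← Complex.exp_add]
    congr 1
    rw [hz1, hτ1]
    field_simp
    linear_combination (16 * ε * τ * (α * c + ε * τ * I)) * I_sq
  rw [h0, jacobiTheta₂'_functional_equation, e1, e2, e3, eta_neg_one_div hτ,
    (hasDerivAt_thetaChar hα c hτ ε).deriv, thetaChar, ← hz, jacobiTheta₂_neg_left,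
    jacobiTheta₂'_neg_left, ← e4]
  have e5 : z1 = -z * τ1 := by
    rw [← e1, div_mul_cancel₀]
    rw [hτ1]
    simp [hα0, hτ0]
  generalize cexp (Real.pi * ε * α * c) = A1
  generalize cexp (Real.pi * I * (-1 / τ) * α ^ 2 * c ^ 2 / 4) = A2
  generalize cexp (-Real.pi * I * z1 ^ 2 / τ1) = A3
  rw [e5]
  generalize jacobiTheta₂' z (τ / α ^ 2) = J'
  generalize jacobiTheta₂ z (τ / α ^ 2) = J
  have e7 : τ1⁻¹ = -τ / α ^ 2 := by
    rw [hτ1]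
    field_simp
  have e8 : c / 2 = z - I * ε * τ / α := by rw [hz]; ring
  rw [show c / (2 * (α : ℂ)) = (c / 2) / α by field_simp, e8]
  have e10 : τ1 = (-τ / α ^ 2)⁻¹ := by rw [← e7, inv_inv]
  rw [e10]
  clear_value z
  field_simp
  ring_nf
  simp only [I_sq]
  ring

/-- A two-sided series splits over any set of representatives `ρ` of the residue classes. -/
lemma tsum_int_eq_sum_residues {ι : Type*} [Fintype ι] {N : ℕ} [NeZero N] (ρ : ι → ℤ)
    (hρ : Function.Bijective fun i => (ρ i : ZMod N)) {f : ℤ → ℂ} (hf : Summable f) :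
    ∑' M : ℤ, f M = ∑ i, ∑' k : ℤ, f (ρ i + N * k) := by
  have hN : (N : ℤ) ≠ 0 := by exact_mod_cast NeZero.ne N
  have hb : Function.Bijective fun x : ι × ℤ => ρ x.1 + N * x.2 := by
    constructor
    · rintro ⟨i, k⟩ ⟨j, l⟩ h
      simp only at h
      have hij : i = j := by
        apply hρ.1
        have := congrArg (Int.cast : ℤ → ZMod N) h
        simpa using this
      subst hij
      have : k = l := by
        have h' : (N : ℤ) * k = N * l := by linarith
        exact mul_left_cancel₀ hN h'
      rw [this]
    · intro M
      obtain ⟨i, hi⟩ := hρ.2 (M : ZMod N)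
      have hd : (N : ℤ) ∣ M - ρ i := (ZMod.intCast_eq_intCast_iff_dvd_sub _ _ _).mp hi
      obtain ⟨k, hk⟩ := hd
      exact ⟨(i, k), by simp only; linarith⟩
  have e := (Equiv.ofBijective _ hb).tsum_eq f
  rw [← e]
  have hs := (Equiv.ofBijective _ hb).summable_iff.mpr hf
  have h2 := hs.tsum_prod
  simp only [Function.comp_apply, Equiv.ofBijective_apply] at h2
  simp only [Equiv.ofBijective_apply]
  rw [h2, tsum_fintype]

lemma bijective_fin_cast (N : ℕ) [NeZero N] :
    Function.Bijective fun i : Fin N => (((i : ℕ) : ℤ) : ZMod N) := by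
  rw [Fintype.bijective_iff_injective_and_card]
  refine ⟨fun i j h => ?_, by simp [ZMod.card]⟩
  simp only [Int.cast_natCast] at h
  have := (ZMod.natCast_eq_natCast_iff' _ _ _).mp h
  rw [Nat.mod_eq_of_lt i.2, Nat.mod_eq_of_lt j.2] at this
  exact Fin.ext this

lemma cexp_pi_mul_I_mul_int_periodic {c : ℂ} {P : ℕ} {N : ℤ} (hc : P * c = N) (m k : ℤ) :
    cexp (Real.pi * I * (m + (2 * P : ℕ) * k : ℤ) * c) = cexp (Real.pi * I * m * c) := by
  rw [Complex.exp_eq_exp_iff_exists_int]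
  refine ⟨k * N, ?_⟩
  push_cast
  linear_combination (2 * Real.pi * I * k) * hc

/-- Summing `θ_{p₊p₋,m}` over `m` against a character trivial on `2p₊p₋` gives a Jacobi theta
function: the residue `m` and the index `k` of `θ_{p₊p₋,m}` combine to `M = m + 2p₊p₋k`. -/
lemma sum_cexp_mul_thetaFun {pp pm : ℕ} (hpp : 1 ≤ pp) (hpm : 1 ≤ pm) (ε c : ℂ) {N : ℤ}
    (hc : ((pp * pm : ℕ) : ℂ) * c = N) {τ : ℂ} (hτ : 0 < τ.im) :
    qpow (-ε ^ 2 / 2) τ * ∑ m ∈ Finset.range (2 * pp * pm), cexp (Real.pi * I * m * c) *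
      (thetaFun (pp * pm) m (I * alphaFull pp pm * ε * τ) τ / ModularForm.eta τ) =
      thetaChar (alphaFull pp pm) c τ ε := by
  have hα := alphaFull_pos hpp hpm
  have hα0 : (alphaFull pp pm : ℂ) ≠ 0 := by exact_mod_cast hα.ne'
  have hα2 : (alphaFull pp pm : ℂ) ^ 2 = 2 * pp * pm := by exact_mod_cast alphaFull_sq pp pm
  have h1 : (pp : ℂ) ≠ 0 := by exact_mod_cast (by omega : pp ≠ 0)
  have h2 : (pm : ℂ) ≠ 0 := by exact_mod_cast (by omega : pm ≠ 0)
  have : NeZero (2 * (pp * pm)) := ⟨by positivity⟩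
  have hs := (summable_jacobiTheta₂_term_iff
    (c / 2 + I * ε * τ / alphaFull pp pm) _).mpr (im_div_sq_pos hα hτ)
  rw [thetaChar, jacobiTheta₂,
    tsum_int_eq_sum_residues (N := 2 * (pp * pm)) _ (bijective_fin_cast _) hs, mul_assoc 2 pp pm,
    Fin.sum_univ_eq_sum_range (fun m => ∑' k : ℤ, jacobiTheta₂_term
      ((m : ℤ) + (2 * (pp * pm) : ℕ) * k) (c / 2 + I * ε * τ / alphaFull pp pm)
      (τ / alphaFull pp pm ^ 2)), Finset.mul_sum, Finset.mul_sum, Finset.mul_sum]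
  refine Finset.sum_congr rfl fun m _ => ?_
  have key : ∀ k : ℤ, cexp (2 * Real.pi * I * (I * alphaFull pp pm * ε * τ) *
      (k + (m : ℤ) / (2 * (pp * pm : ℕ)))) *
        qpow ((pp * pm : ℕ) * ((k : ℂ) + (m : ℤ) / (2 * (pp * pm : ℕ))) ^ 2) τ *
        cexp (Real.pi * I * m * c) =
      jacobiTheta₂_term ((m : ℤ) + (2 * (pp * pm) : ℕ) * k)
        (c / 2 + I * ε * τ / alphaFull pp pm) (τ / alphaFull pp pm ^ 2) := by
    intro k
    have hper := cexp_pi_mul_I_mul_int_periodic hc m k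
    rw [Int.cast_natCast] at hper
    rw [← hper, jacobiTheta₂_term, qpow, ← Complex.exp_add, ← Complex.exp_add]
    congr 1
    have hα3 : I * ε * τ / (alphaFull pp pm : ℂ) =
        I * ε * τ * alphaFull pp pm / (2 * pp * pm) := by
      rw [← hα2]
      field_simp
    rw [hα3, hα2]
    push_cast
    field_simp
    ring
  have h3 := tsum_congr (L := .unconditional ℤ) key
  rw [tsum_mul_right] at h3
  rw [← h3, thetaFun]
  ring

lemma neg_one_zpow_mul_eq (m n : ℤ) : (-1 : ℂ) ^ (m * n) = cexp (Real.pi * I * m * n) := by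
  rw [zpow_mul, ← Complex.exp_pi_mul_I, ← Complex.exp_int_mul, ← Complex.exp_int_mul]
  congr 1
  ring

lemma cexp_pi_mul_I_mul_add (m : ℕ) (n : ℤ) (a b : ℂ) :
    cexp (Real.pi * I * m * (n + a + b)) = (-1 : ℂ) ^ ((m : ℤ) * n) *
      (cexp (Real.pi * (a * m) * I) * cexp (Real.pi * (b * m) * I)) := by
  rw [neg_one_zpow_mul_eq, ← Complex.exp_add, ← Complex.exp_add]
  congr 1
  push_cast
  ring

lemma cexp_quad_eq (m : ℕ) (n : ℤ) (a b : ℂ) :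
    cexp (Real.pi * I * m * (n + a + b)) = (-1 : ℂ) ^ ((m : ℤ) * n) *
      (cexp (Real.pi * (a * m) * I) * cexp (Real.pi * (b * m) * I)) ∧
    cexp (Real.pi * I * m * (n - a - b)) = (-1 : ℂ) ^ ((m : ℤ) * n) *
      (cexp (-(Real.pi * (a * m)) * I) * cexp (-(Real.pi * (b * m)) * I)) ∧
    cexp (Real.pi * I * m * (n - a + b)) = (-1 : ℂ) ^ ((m : ℤ) * n) *
      (cexp (-(Real.pi * (a * m)) * I) * cexp (Real.pi * (b * m) * I)) ∧
    cexp (Real.pi * I * m * (n + a - b)) = (-1 : ℂ) ^ ((m : ℤ) * n) *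
      (cexp (Real.pi * (a * m) * I) * cexp (-(Real.pi * (b * m)) * I)) := by
  refine ⟨cexp_pi_mul_I_mul_add m n a b, ?_, ?_, ?_⟩
  · simpa [sub_eq_add_neg] using cexp_pi_mul_I_mul_add m n (-a) (-b)
  · simpa [sub_eq_add_neg] using cexp_pi_mul_I_mul_add m n (-a) b
  · simpa [sub_eq_add_neg] using cexp_pi_mul_I_mul_add m n a (-b)

/-- The three weighted theta sums are Fourier combinations of the functions `thetaChar`. -/
lemma thetaSum_eq {pp pm : ℕ} (hpp : 1 ≤ pp) (hpm : 1 ≤ pm) (r s n : ℤ) (ε : ℂ) {τ : ℂ}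
    (hτ : 0 < τ.im) :
    let T : ℂ → ℂ := fun c => thetaChar (alphaFull pp pm) c τ ε
    let a : ℂ := r / pp
    let b : ℂ := s / pm
    thetaSum pp pm n (weightSinSin pp pm r s) ε τ =
      -1 / 4 * (T (n + a + b) + T (n - a - b) - T (n - a + b) - T (n + a - b)) ∧
    thetaSum pp pm n (weightCosSin pp pm r s) ε τ =
      -I / 4 * (T (n + a + b) - T (n - a - b) + T (n - a + b) - T (n + a - b)) ∧
    thetaSum pp pm n (weightSinCos pp pm r s) ε τ =
      -I / 4 * (T (n + a + b) - T (n - a - b) - T (n - a + b) + T (n + a - b)) := by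
  intro T a b
  have h1 : (pp : ℂ) ≠ 0 := by exact_mod_cast (by omega : pp ≠ 0)
  have h2 : (pm : ℂ) ≠ 0 := by exact_mod_cast (by omega : pm ≠ 0)
  have t1 : T (n + a + b) = _ := (sum_cexp_mul_thetaFun hpp hpm ε (c := n + a + b)
    (N := n * pp * pm + r * pm + s * pp) (by push_cast; simp only [a, b]; field_simp) hτ).symm
  have t2 : T (n - a - b) = _ := (sum_cexp_mul_thetaFun hpp hpm ε (c := n - a - b)
    (N := n * pp * pm - r * pm - s * pp) (by push_cast; simp only [a, b]; field_simp) hτ).symm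
  have t3 : T (n - a + b) = _ := (sum_cexp_mul_thetaFun hpp hpm ε (c := n - a + b)
    (N := n * pp * pm - r * pm + s * pp) (by push_cast; simp only [a, b]; field_simp) hτ).symm
  have t4 : T (n + a - b) = _ := (sum_cexp_mul_thetaFun hpp hpm ε (c := n + a - b)
    (N := n * pp * pm + r * pm - s * pp) (by push_cast; simp only [a, b]; field_simp) hτ).symm
  have ea : ∀ m : ℕ, (Real.pi : ℂ) * (r * m / pp) = Real.pi * (a * m) := fun m => by
    simp only [a]; ring
  have eb : ∀ m : ℕ, (Real.pi : ℂ) * (s * m / pm) = Real.pi * (b * m) := fun m => by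
    simp only [b]; ring
  rw [t1, t2, t3, t4]
  simp only [thetaSum, Finset.mul_sum, ← Finset.sum_add_distrib, ← Finset.sum_sub_distrib]
  refine ⟨Finset.sum_congr rfl fun m _ => ?_, Finset.sum_congr rfl fun m _ => ?_,
    Finset.sum_congr rfl fun m _ => ?_⟩
  all_goals
    obtain ⟨c1, c2, c3, c4⟩ := cexp_quad_eq m n a b
    rw [c1, c2, c3, c4]
    simp only [weightSinSin, weightCosSin, weightSinCos]
    push_cast
    rw [ea, eb]
    simp only [Complex.sin, Complex.cos]
    generalize cexp (Real.pi * (a * m) * I) = A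
    generalize cexp (-(Real.pi * (a * m)) * I) = A'
    generalize cexp (Real.pi * (b * m) * I) = B
    generalize cexp (-(Real.pi * (b * m)) * I) = B'
    generalize thetaFun (pp * pm) m (I * alphaFull pp pm * ε * τ) τ = Θ
    ring_nf <;> simp only [I_sq] <;> ring

/-- The derivative of `Θ_{sin sin}` is computed through `thetaChar`. -/
lemma differentiableAt_thetaSum {pp pm : ℕ} (hpp : 1 ≤ pp) (hpm : 1 ≤ pm) (r s n : ℤ) (ε : ℂ)
    {τ : ℂ} (hτ : 0 < τ.im) :
    DifferentiableAt ℂ (fun e => thetaSum pp pm n (weightSinSin pp pm r s) e τ) ε ∧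
    deriv (fun e => thetaSum pp pm n (weightSinSin pp pm r s) e τ) ε =
      -1 / 4 * (deriv (thetaChar (alphaFull pp pm) (n + r / pp + s / pm) τ) ε +
        deriv (thetaChar (alphaFull pp pm) (n - r / pp - s / pm) τ) ε -
        deriv (thetaChar (alphaFull pp pm) (n - r / pp + s / pm) τ) ε -
        deriv (thetaChar (alphaFull pp pm) (n + r / pp - s / pm) τ) ε) := by
  have hd := fun c =>
    (hasDerivAt_thetaChar (alphaFull_pos hpp hpm) c hτ ε).differentiableAt.hasDerivAt
  have h := ((((hd (n + r / pp + s / pm)).add (hd (n - r / pp - s / pm))).sub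
    (hd (n - r / pp + s / pm))).sub (hd (n + r / pp - s / pm))).const_mul (-1 / 4)
  have e : (fun e => thetaSum pp pm n (weightSinSin pp pm r s) e τ) = fun e => -1 / 4 *
      ((((thetaChar (alphaFull pp pm) (n + r / pp + s / pm) τ +
        thetaChar (alphaFull pp pm) (n - r / pp - s / pm) τ) -
        thetaChar (alphaFull pp pm) (n - r / pp + s / pm) τ) -
        thetaChar (alphaFull pp pm) (n + r / pp - s / pm) τ) e) := by
    funext e
    exact (thetaSum_eq hpp hpm r s n e hτ).1
  rw [e]
  exact ⟨h.differentiableAt, h.deriv⟩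

/-- The correction term is the two-sided weighted series. -/
lemma tsum_mul_quadTerm {pp pm : ℕ} (hpp : 1 ≤ pp) (hpm : 1 ≤ pm) (r s n : ℤ) (ε : ℂ) {τ : ℂ}
    (hτ : 0 < τ.im) :
    ∑' K : ℤ, (K : ℂ) * quadTerm (alphaFull pp pm) ε (r / pp) (s / pm) n (-1 / τ) K =
      correctionY pp pm ε r s n τ := by
  have hα := alphaFull_pos hpp hpm
  have hα0 : (alphaFull pp pm : ℂ) ≠ 0 := by exact_mod_cast hα.ne'
  have hα2 : (alphaFull pp pm : ℂ) ^ 2 = 2 * pp * pm := by exact_mod_cast alphaFull_sq pp pm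
  have h1 : (pp : ℂ) ≠ 0 := by exact_mod_cast (by omega : pp ≠ 0)
  have h2 : (pm : ℂ) ≠ 0 := by exact_mod_cast (by omega : pm ≠ 0)
  have hπ : (Real.pi : ℂ) ≠ 0 := by exact_mod_cast Real.pi_ne_zero
  have hS := fun c => (summable_mul_fockTerm hα ε c (neg_one_div_im_pos hτ)).hasSum
  have h := ((((hS (n + r / pp + s / pm)).add (hS (n - r / pp - s / pm))).sub
    (hS (n - r / pp + s / pm))).sub (hS (n + r / pp - s / pm))).tsum_eq
  have e : ∀ K : ℤ, (K : ℂ) * quadTerm (alphaFull pp pm) ε (r / pp) (s / pm) n (-1 / τ) K =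
      (K : ℂ) * fockTerm (alphaFull pp pm) ε (n + r / pp + s / pm - 2 * K) (-1 / τ) +
      (K : ℂ) * fockTerm (alphaFull pp pm) ε (n - r / pp - s / pm - 2 * K) (-1 / τ) -
      (K : ℂ) * fockTerm (alphaFull pp pm) ε (n - r / pp + s / pm - 2 * K) (-1 / τ) -
      (K : ℂ) * fockTerm (alphaFull pp pm) ε (n + r / pp - s / pm - 2 * K) (-1 / τ) := by
    intro K
    rw [quadTerm_eq]
    ring
  obtain ⟨w1, w2, w3⟩ := thetaSum_eq hpp hpm r s n ε hτ
  rw [tsum_congr e, h, correctionY, (differentiableAt_thetaSum hpp hpm r s n ε hτ).2, w1, w2, w3]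
  simp only [tsum_mul_fockTerm hα ε _ hτ, hα2]
  generalize deriv (thetaChar (alphaFull pp pm) (n + r / pp + s / pm) τ) ε = D1
  generalize deriv (thetaChar (alphaFull pp pm) (n - r / pp - s / pm) τ) ε = D2
  generalize deriv (thetaChar (alphaFull pp pm) (n - r / pp + s / pm) τ) ε = D3
  generalize deriv (thetaChar (alphaFull pp pm) (n + r / pp - s / pm) τ) ε = D4
  generalize thetaChar (alphaFull pp pm) (n + r / pp + s / pm) τ ε = T1
  generalize thetaChar (alphaFull pp pm) (n - r / pp - s / pm) τ ε = T2
  generalize thetaChar (alphaFull pp pm) (n - r / pp + s / pm) τ ε = T3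
  generalize thetaChar (alphaFull pp pm) (n + r / pp - s / pm) τ ε = T4
  field_simp
  ring_nf
  simp only [I_sq]
  ring

/-- The one-sided weighted series at `-1/τ`. For `Re ε > 0` it is the integral; for `Re ε < 0` the
integral is the series over `-j`, and the two-sided series, which is the correction term,
remains. -/
lemma tsum_nat_mul_quadTerm {pp pm : ℕ} (hpp : 1 ≤ pp) (hpm : 1 ≤ pm) (r s n : ℤ) {ε : ℂ}
    (hε : ε.re ≠ 0) {τ : ℂ} (hτ : 0 < τ.im) :
    Integrable (fun x : ℝ => kernelS pp pm ε r s n x *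
      regFockCh pp pm ε (x + alphaZero pp pm / 2) τ) ∧
    ∑' j : ℕ, (j : ℂ) * quadTerm (alphaFull pp pm) ε (r / pp) (s / pm) n (-1 / τ) j =
      (∫ x : ℝ, kernelS pp pm ε r s n x * regFockCh pp pm ε (x + alphaZero pp pm / 2) τ) +
        (1 - (Real.sign ε.re : ℂ)) / 2 * correctionY pp pm ε r s n τ := by
  have hα := alphaFull_pos hpp hpm
  simp_rw [kernelS_mul_regFockCh hpp hpm ε r s n hτ]
  rcases hε.lt_or_gt with h | h
  · have hσ : (0 : ℝ) < (-1 : ℤ) * (alphaFull pp pm * ε.re) := by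
      have := mul_neg_of_pos_of_neg hα h
      push_cast
      linarith
    obtain ⟨hint, hsum⟩ := hasSum_quadTerm (Or.inr rfl) hσ (r / pp) (s / pm) n hτ
    refine ⟨hint, ?_⟩
    have hZ := summable_mul_quadTerm hα ε (r / pp) (s / pm) n (neg_one_div_im_pos hτ)
    have h1 := hZ.hasSum.nat_add_neg.add hsum
    rw [tsum_mul_quadTerm hpp hpm r s n ε hτ] at h1
    have e : ∀ j : ℕ, ((j : ℤ) : ℂ) * quadTerm (alphaFull pp pm) ε (r / pp) (s / pm) n (-1 / τ) j +
        ((-(j : ℤ) : ℤ) : ℂ) * quadTerm (alphaFull pp pm) ε (r / pp) (s / pm) n (-1 / τ) (-j) +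
        (j : ℂ) * quadTerm (alphaFull pp pm) ε (r / pp) (s / pm) n (-1 / τ) (-1 * j) =
        (j : ℂ) * quadTerm (alphaFull pp pm) ε (r / pp) (s / pm) n (-1 / τ) j := by
      intro j
      push_cast
      rw [neg_one_mul]
      ring
    simp_rw [e] at h1
    rw [Real.sign_of_neg h, h1.tsum_eq]
    push_cast
    ring
  · have hσ : (0 : ℝ) < (1 : ℤ) * (alphaFull pp pm * ε.re) := by
      have := mul_pos hα h
      push_cast
      linarith
    obtain ⟨hint, hsum⟩ := hasSum_quadTerm (Or.inl rfl) hσ (r / pp) (s / pm) n hτ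
    refine ⟨hint, ?_⟩
    rw [Real.sign_of_pos h, ← hsum.tsum_eq]
    simp

/-! ### The modular inversion of the minimal model characters -/

/-- The total mass of the Fock characters over a full coset, transformed by `τ ↦ -1/τ`. -/
lemma tsum_fockTerm {α : ℝ} (hα : 0 < α) (c : ℂ) {τ : ℂ} (hτ : 0 < τ.im) :
    ∑' K : ℤ, fockTerm α 0 (c - 2 * K) (-1 / τ) =
      (α * ModularForm.eta τ)⁻¹ * jacobiTheta₂ (c / 2) (τ / α ^ 2) := by
  have hτ0 : τ ≠ 0 := by rintro rfl; simp at hτ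
  have hα0 : (α : ℂ) ≠ 0 := by exact_mod_cast hα.ne'
  have heta := ModularForm.eta_ne_zero (show τ ∈ UpperHalfPlane.upperHalfPlaneSet from hτ)
  set τ1 : ℂ := α ^ 2 * (-1 / τ) with hτ1
  set z1 : ℂ := I * 0 * α - -1 / τ * α ^ 2 * c / 2 with hz1
  have hκ : (-I * τ) ^ (1 / 2 : ℂ) ≠ 0 := by simp [cpow_eq_zero_iff, hτ0]
  have e1 : z1 / τ1 = -(c / 2) := by
    rw [hz1, hτ1]
    field_simp
    ring
  have e2 : -1 / τ1 = τ / α ^ 2 := by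
    rw [hτ1]
    field_simp
  have e4 : cexp (Real.pi * 0 * α * c) * cexp (Real.pi * I * (-1 / τ) * α ^ 2 * c ^ 2 / 4) *
      cexp (-Real.pi * I * z1 ^ 2 / τ1) = 1 := by
    rw [← Complex.exp_add, ← Complex.exp_add]
    convert! Complex.exp_zero using 2
    rw [hz1, hτ1]
    field_simp
    ring
  simp_rw [fockTerm_eq_jacobiTheta₂_term]
  rw [tsum_mul_left, ← hz1, ← hτ1, ← jacobiTheta₂, jacobiTheta₂_functional_equation, e1, e2,
    neg_I_mul_cpow_half hα hτ, eta_neg_one_div hτ, jacobiTheta₂_neg_left]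
  generalize jacobiTheta₂ (c / 2) (τ / α ^ 2) = J
  generalize (-I * τ) ^ (1 / 2 : ℂ) = κ at hκ
  calc _ = cexp (Real.pi * 0 * α * c) * cexp (Real.pi * I * (-1 / τ) * α ^ 2 * c ^ 2 / 4) *
      cexp (-Real.pi * I * z1 ^ 2 / τ1) * ((α * ModularForm.eta τ)⁻¹ * J) := by
        generalize cexp (Real.pi * 0 * α * c) *
          cexp (Real.pi * I * (-1 / τ) * α ^ 2 * c ^ 2 / 4) = A
        generalize cexp (-Real.pi * I * z1 ^ 2 / τ1) = B
        field_simp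
    _ = _ := by rw [e4, one_mul]

/-- The theta series `∑ q ^ (M² / 4p₊p₋)` over the integers `M` congruent to `j` modulo
`2p₊p₋`. -/
def classTheta (pp pm : ℕ) (j : ℤ) (τ : ℂ) : ℂ :=
  ∑' k : ℤ, jacobiTheta₂_term (j + (2 * (pp * pm) : ℕ) * k) 0 (τ / alphaFull pp pm ^ 2)

lemma classTheta_neg (pp pm : ℕ) (j : ℤ) (τ : ℂ) :
    classTheta pp pm (-j) τ = classTheta pp pm j τ := by
  rw [classTheta, classTheta, ← (Equiv.neg ℤ).tsum_eq]
  refine tsum_congr fun k => ?_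
  rw [jacobiTheta₂_term, jacobiTheta₂_term, Equiv.neg_apply]
  push_cast
  ring_nf

lemma classTheta_add (pp pm : ℕ) (j l : ℤ) (τ : ℂ) :
    classTheta pp pm (j + (2 * (pp * pm) : ℕ) * l) τ = classTheta pp pm j τ := by
  rw [classTheta, classTheta, ← (Equiv.addLeft l).tsum_eq (fun k =>
    jacobiTheta₂_term (j + (2 * (pp * pm) : ℕ) * k) 0 (τ / alphaFull pp pm ^ 2))]
  refine tsum_congr fun k => ?_
  rw [Equiv.coe_addLeft]
  congr 1
  ring

lemma summable_jacobiTheta₂_term_class {pp pm : ℕ} (hpp : 1 ≤ pp) (hpm : 1 ≤ pm) (j : ℤ) {τ : ℂ}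
    (hτ : 0 < τ.im) : Summable fun k : ℤ =>
      jacobiTheta₂_term (j + (2 * (pp * pm) : ℕ) * k) 0 (τ / alphaFull pp pm ^ 2) := by
  have hs := (summable_jacobiTheta₂_term_iff 0 _).mpr (im_div_sq_pos (alphaFull_pos hpp hpm) hτ)
  refine hs.comp_injective fun k l h => ?_
  have hN : ((2 * (pp * pm) : ℕ) : ℤ) ≠ 0 := by
    have : 0 < pp * pm := by positivity
    omega
  simp only [add_right_inj] at h
  exact mul_left_cancel₀ hN h

/-- A minimal model character is a difference of two theta series. -/
lemma virCh_eq {pp pm : ℕ} (hpp : 1 ≤ pp) (hpm : 1 ≤ pm) (r s : ℤ) {τ : ℂ} (hτ : 0 < τ.im) :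
    virCh pp pm r s τ = (ModularForm.eta τ)⁻¹ *
      (classTheta pp pm (s * pp - r * pm) τ - classTheta pp pm (s * pp + r * pm) τ) := by
  have hα0 : (alphaFull pp pm : ℂ) ≠ 0 := by exact_mod_cast (alphaFull_pos hpp hpm).ne'
  have hα2 : (alphaFull pp pm : ℂ) ^ 2 = 2 * pp * pm := by exact_mod_cast alphaFull_sq pp pm
  have h1 : (pp : ℂ) ≠ 0 := by exact_mod_cast (by omega : pp ≠ 0)
  have h2 : (pm : ℂ) ≠ 0 := by exact_mod_cast (by omega : pm ≠ 0)
  have hs := fun j => summable_jacobiTheta₂_term_class hpp hpm j hτ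
  rw [virCh, classTheta, classTheta, ← (hs _).tsum_sub (hs _), ← tsum_mul_left]
  refine tsum_congr fun k => ?_
  rw [fockCh_eq _ _ _ hτ, fockCh_eq _ _ _ hτ, alphaRSN_sub hpp hpm, alphaRSN_sub hpp hpm,
    jacobiTheta₂_term, jacobiTheta₂_term, qpow, qpow, hα2, mul_sub, div_eq_inv_mul, div_eq_inv_mul]
  congr 3
  · rw [div_pow, mul_pow, hα2]
    push_cast
    field_simp
    ring
  · rw [div_pow, mul_pow, hα2]
    push_cast
    field_simp
    ring_nf

/-- The even `2 p₊ p₋`-periodic coefficient `sin (π r M / p₊) sin (π s M / p₋)`. -/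
def weightInt (pp pm : ℕ) (r s M : ℤ) : ℝ :=
  Real.sin (Real.pi * (r * M / pp)) * Real.sin (Real.pi * (s * M / pm))

lemma weightInt_neg (pp pm : ℕ) (r s M : ℤ) :
    weightInt pp pm r s (-M) = weightInt pp pm r s M := by
  simp only [weightInt, Int.cast_neg, mul_neg, neg_div, Real.sin_neg]
  ring

lemma weightInt_add {pp pm : ℕ} (hpp : 1 ≤ pp) (hpm : 1 ≤ pm) (r s M l : ℤ) :
    weightInt pp pm r s (M + (2 * (pp * pm) : ℕ) * l) = weightInt pp pm r s M := by
  have h1 : (pp : ℝ) ≠ 0 := by exact_mod_cast (by omega : pp ≠ 0)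
  have h2 : (pm : ℝ) ≠ 0 := by exact_mod_cast (by omega : pm ≠ 0)
  rw [weightInt, weightInt]
  congr 1
  · rw [← Real.sin_add_int_mul_two_pi (Real.pi * (r * M / pp)) (r * pm * l)]
    congr 1
    push_cast
    field_simp
  · rw [← Real.sin_add_int_mul_two_pi (Real.pi * (s * M / pm)) (s * pp * l)]
    congr 1
    push_cast
    field_simp

lemma weightInt_eq_zero_left {pp pm : ℕ} (hpp : 1 ≤ pp) (r s : ℤ) {M : ℤ} (h : (pp : ℤ) ∣ r * M) :
    weightInt pp pm r s M = 0 := by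
  obtain ⟨l, hl⟩ := h
  have h1 : (pp : ℝ) ≠ 0 := by exact_mod_cast (by omega : pp ≠ 0)
  have : Real.pi * (r * M / pp) = l * Real.pi := by
    have : (r * M : ℝ) = pp * l := by exact_mod_cast hl
    rw [this]
    field_simp
  rw [weightInt, this, Real.sin_int_mul_pi, zero_mul]

lemma weightInt_eq_zero_right {pp pm : ℕ} (hpm : 1 ≤ pm) (r s : ℤ) {M : ℤ}
    (h : (pm : ℤ) ∣ s * M) : weightInt pp pm r s M = 0 := by
  obtain ⟨l, hl⟩ := h
  have h1 : (pm : ℝ) ≠ 0 := by exact_mod_cast (by omega : pm ≠ 0)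
  have : Real.pi * (s * M / pm) = l * Real.pi := by
    have : (s * M : ℝ) = pm * l := by exact_mod_cast hl
    rw [this]
    field_simp
  rw [weightInt, this, Real.sin_int_mul_pi, mul_zero]

/-- The reflection `s ↦ p₋ - s`, which relates odd `n` to even `n`. -/
lemma weightInt_sub_right {pp pm : ℕ} (hpm : 1 ≤ pm) (r s M : ℤ) :
    weightInt pp pm r (pm - s) M = -((-1) ^ M * weightInt pp pm r s M) := by
  have h1 : (pm : ℝ) ≠ 0 := by exact_mod_cast (by omega : pm ≠ 0)
  have : Real.pi * (((pm - s : ℤ) : ℝ) * M / pm) = M * Real.pi - Real.pi * (s * M / pm) := by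
    push_cast
    field_simp
  rw [weightInt, this, Real.sin_int_mul_pi_sub, weightInt]
  ring

lemma weightInt_corner {pp pm : ℕ} (hpp : 1 ≤ pp) (hpm : 1 ≤ pm) (r s r' s' : ℤ) :
    weightInt pp pm r s (s' * pp + r' * pm) = (-1) ^ (s' * r) * (-1) ^ (r' * s) *
      (Real.sin (Real.pi * (r * r' * pm / pp)) * Real.sin (Real.pi * (s * s' * pp / pm))) := by
  have h1 : (pp : ℝ) ≠ 0 := by exact_mod_cast (by omega : pp ≠ 0)
  have h2 : (pm : ℝ) ≠ 0 := by exact_mod_cast (by omega : pm ≠ 0)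
  have e1 : Real.pi * (r * ((s' * pp + r' * pm : ℤ) : ℝ) / pp) =
      Real.pi * (r * r' * pm / pp) + ((s' * r : ℤ) : ℝ) * Real.pi := by
    push_cast
    field_simp
    ring
  have e2 : Real.pi * (s * ((s' * pp + r' * pm : ℤ) : ℝ) / pm) =
      Real.pi * (s * s' * pp / pm) + ((r' * s : ℤ) : ℝ) * Real.pi := by
    push_cast
    field_simp
  rw [weightInt, e1, e2, Real.sin_add_int_mul_pi, Real.sin_add_int_mul_pi]
  ring

lemma weightInt_corner_neg {pp pm : ℕ} (hpp : 1 ≤ pp) (hpm : 1 ≤ pm) (r s r' s' : ℤ) :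
    weightInt pp pm r s (s' * pp - r' * pm) = -weightInt pp pm r s (s' * pp + r' * pm) := by
  have h := weightInt_corner hpp hpm r s (-r') s'
  rw [show s' * (pp : ℤ) + -r' * pm = s' * pp - r' * pm by ring] at h
  rw [h, weightInt_corner hpp hpm]
  have e : Real.pi * ((r : ℝ) * ((-r' : ℤ) : ℝ) * pm / pp) =
      -(Real.pi * (r * r' * pm / pp)) := by
    push_cast
    ring
  rw [e, Real.sin_neg, neg_mul r', zpow_neg, ← inv_zpow, inv_neg, inv_one]
  ring

lemma sqrt_eight_div {pp pm : ℕ} (hpp : 1 ≤ pp) (hpm : 1 ≤ pm) :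
    Real.sqrt (8 / (pp * pm)) = 4 / alphaFull pp pm := by
  have hα := alphaFull_pos hpp hpm
  have h1 : (pp : ℝ) ≠ 0 := by exact_mod_cast (by omega : pp ≠ 0)
  have h2 : (pm : ℝ) ≠ 0 := by exact_mod_cast (by omega : pm ≠ 0)
  rw [Real.sqrt_eq_iff_mul_self_eq (by positivity) (by positivity), div_mul_div_comm, ← pow_two,
    ← pow_two, alphaFull_sq]
  field_simp
  norm_num

/-- The `S`-matrix samples the periodic coefficient at the corner `s' p₊ + r' p₋`. -/
lemma virS_eq {pp pm : ℕ} (hpp : 1 ≤ pp) (hpm : 1 ≤ pm) (r s r' s' : ℤ) :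
    virS pp pm r s r' s' =
      -(4 / alphaFull pp pm * weightInt pp pm r s (s' * pp + r' * pm)) := by
  have h1 : (pp : ℝ) ≠ 0 := by exact_mod_cast (by omega : pp ≠ 0)
  have h2 : (pm : ℝ) ≠ 0 := by exact_mod_cast (by omega : pm ≠ 0)
  have e1 : Real.pi * r * r' * (pm - pp) / pp =
      Real.pi * (r * r' * pm / pp) - ((r * r' : ℤ) : ℝ) * Real.pi := by
    push_cast
    field_simp
  have e2 : Real.pi * s * s' * (pm - pp) / pm =
      ((s * s' : ℤ) : ℝ) * Real.pi - Real.pi * (s * s' * pp / pm) := by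
    push_cast
    field_simp
  have h0 : (-1 : ℝ) ≠ 0 := by norm_num
  have hsq : ∀ k : ℤ, (-1 : ℝ) ^ k * (-1) ^ k = 1 := by
    intro k
    rw [← mul_zpow]
    norm_num
  rw [virS, e1, e2, Real.sin_sub_int_mul_pi, Real.sin_int_mul_pi_sub, sqrt_eight_div hpp hpm,
    weightInt_corner hpp hpm, show (r + s) * (r' + s') = r * r' + s * s' + s' * r + r' * s by ring,
    zpow_add₀ h0, zpow_add₀ h0, zpow_add₀ h0]
  linear_combination (-4 / alphaFull pp pm * (-1) ^ (s' * r) * (-1) ^ (r' * s) *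
    Real.sin (Real.pi * (r * r' * pm / pp)) * Real.sin (Real.pi * (s * s' * pp / pm))) *
    ((-1) ^ (s * s') * (-1) ^ (s * s') * hsq (r * r') + hsq (s * s'))

lemma sum_Ico_neg (p : ℕ) (G : ℤ → ℂ) :
    ∑ x ∈ Finset.Ico (-((p + 1 : ℕ) : ℤ)) ((p + 1 : ℕ) : ℤ), G x =
      G (-((p + 1 : ℕ) : ℤ)) + G 0 +
        ∑ x ∈ Finset.Ico (1 : ℤ) ((p + 1 : ℕ) : ℤ), (G x + G (-x)) := by
  induction p with
  | zero =>
    have h1 : Finset.Ico (-((0 + 1 : ℕ) : ℤ)) ((0 + 1 : ℕ) : ℤ) = {-1, 0} := by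
      ext x
      simp only [Finset.mem_Ico, Finset.mem_insert, Finset.mem_singleton]
      omega
    rw [h1]
    simp
  | succ p ih =>
    have h1 : Finset.Ico (-((p + 1 + 1 : ℕ) : ℤ)) ((p + 1 + 1 : ℕ) : ℤ) =
        insert (-((p + 1 + 1 : ℕ) : ℤ)) (insert ((p + 1 : ℕ) : ℤ)
          (Finset.Ico (-((p + 1 : ℕ) : ℤ)) ((p + 1 : ℕ) : ℤ))) := by
      ext x
      simp only [Finset.mem_Ico, Finset.mem_insert]
      omega
    have h2 : Finset.Ico (1 : ℤ) ((p + 1 + 1 : ℕ) : ℤ) =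
        insert ((p + 1 : ℕ) : ℤ) (Finset.Ico (1 : ℤ) ((p + 1 : ℕ) : ℤ)) := by
      ext x
      simp only [Finset.mem_Ico, Finset.mem_insert]
      omega
    rw [h1, h2, Finset.sum_insert, Finset.sum_insert, Finset.sum_insert, ih]
    · ring
    all_goals
      simp only [Finset.mem_Ico, Finset.mem_insert]
      omega

/-- Representatives `s' p₊ + r' p₋` of the residue classes modulo `2 p₊ p₋`. -/
lemma bijective_corner {pp pm : ℕ} (hpp : 1 ≤ pp) (hpm : 1 ≤ pm) (hcop : Nat.Coprime pp pm)
    [NeZero (2 * (pp * pm))] :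
    Function.Bijective fun x : ↥(Finset.Ico (0 : ℤ) pm ×ˢ Finset.Ico (-(pp : ℤ)) pp) =>
      ((x.1.1 * pp + x.1.2 * pm : ℤ) : ZMod (2 * (pp * pm))) := by
  rw [Fintype.bijective_iff_injective_and_card]
  constructor
  · rintro ⟨⟨s1, r1⟩, h1⟩ ⟨⟨s2, r2⟩, h2⟩ h
    simp only [Finset.mem_product, Finset.mem_Ico] at h1 h2
    simp only at h
    have hd := (ZMod.intCast_eq_intCast_iff_dvd_sub _ _ _).mp h
    push_cast at hd
    have hco : IsCoprime (pm : ℤ) (pp : ℤ) := Nat.isCoprime_iff_coprime.mpr hcop.symm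
    have hs : s1 = s2 := by
      have h3 : (pm : ℤ) ∣ (s2 - s1) * pp := by
        have h4 : (pm : ℤ) ∣ (s2 * pp + r2 * pm - (s1 * pp + r1 * pm)) :=
          Dvd.dvd.trans ⟨2 * pp, by ring⟩ hd
        have h5 : (s2 - s1) * (pp : ℤ) =
          (s2 * pp + r2 * pm - (s1 * pp + r1 * pm)) - (r2 - r1) * pm := by ring
        rw [h5]
        exact dvd_sub h4 (Dvd.intro_left _ rfl)
      have h6 := hco.dvd_of_dvd_mul_right h3
      have := Int.eq_zero_of_abs_lt_dvd h6 (by rw [abs_lt]; constructor <;> linarith)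
      linarith
    subst hs
    have hr : r1 = r2 := by
      have h3 : (pm : ℤ) * (2 * pp) ∣ pm * (r2 - r1) := by
        have e1 : (pm : ℤ) * (2 * pp) = 2 * (pp * pm) := by ring
        have e2 : (pm : ℤ) * (r2 - r1) = s1 * pp + r2 * pm - (s1 * pp + r1 * pm) := by ring
        rw [e1, e2]
        exact hd
      have h4 := Int.dvd_of_mul_dvd_mul_left (by omega) h3
      have := Int.eq_zero_of_abs_lt_dvd h4 (by rw [abs_lt]; constructor <;> linarith)
      linarith
    subst hr
    rfl
  · rw [Fintype.card_coe, Finset.card_product, Int.card_Ico, Int.card_Ico, ZMod.card]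
    have e1 : ((pm : ℤ) - 0).toNat = pm := by simp
    have e2 : ((pp : ℤ) - -(pp : ℤ)).toNat = 2 * pp := by omega
    rw [e1, e2]
    ring

/-- Folding a sum over residue classes onto the Kac table. -/
lemma sum_corner_eq {pp pm : ℕ} (hpp : 1 ≤ pp) (hpm : 1 ≤ pm) (hcop : Nat.Coprime pp pm)
    {F : ℤ → ℂ} (hneg : ∀ M, F (-M) = F M)
    (hper : ∀ M l : ℤ, F (M + (2 * (pp * pm) : ℕ) * l) = F M)
    (hzl : ∀ M, (pp : ℤ) ∣ M → F M = 0) (hzr : ∀ M, (pm : ℤ) ∣ M → F M = 0) :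
    ∑ x ∈ Finset.Ico (0 : ℤ) pm ×ˢ Finset.Ico (-(pp : ℤ)) pp, F (x.1 * pp + x.2 * pm) =
      2 * ∑ x ∈ kacTable pp pm, (F (x.2 * pp + x.1 * pm) + F (x.2 * pp - x.1 * pm)) := by
  have hrect : ∑ x ∈ Finset.Ico (0 : ℤ) pm ×ˢ Finset.Ico (-(pp : ℤ)) pp, F (x.1 * pp + x.2 * pm) =
      ∑ x ∈ Finset.Ico (1 : ℤ) pp ×ˢ Finset.Ico (1 : ℤ) pm,
        (F (x.2 * pp + x.1 * pm) + F (x.2 * pp - x.1 * pm)) := by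
    obtain ⟨p, rfl⟩ : ∃ p, pp = p + 1 := ⟨pp - 1, by omega⟩
    rw [Finset.sum_product, Finset.sum_product_right]
    have h0 : Finset.Ico (0 : ℤ) pm = insert 0 (Finset.Ico (1 : ℤ) pm) := by
      ext x
      simp only [Finset.mem_Ico, Finset.mem_insert]
      omega
    rw [h0, Finset.sum_insert (by simp), Finset.sum_eq_zero, zero_add]
    · refine Finset.sum_congr rfl fun s' _ => ?_
      rw [sum_Ico_neg p (fun r' => F (s' * ((p + 1 : ℕ) : ℤ) + r' * pm)), hzl, hzl, zero_add,
        zero_add]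
      · refine Finset.sum_congr rfl fun r' _ => ?_
        rw [neg_mul, ← sub_eq_add_neg]
      · simp
      · exact ⟨s' - pm, by ring⟩
    · intro r' _
      exact hzr _ (by simp)
  rw [hrect, ← Finset.sum_filter_add_sum_filter_not _ (fun x : ℤ × ℤ => x.1 * pm < x.2 * pp),
    ← kacTable, two_mul]
  congr 1
  -- the other half of the rectangle is the image of the Kac table under `(p₊ - r', p₋ - s')`
  refine Finset.sum_nbij' (fun x => (pp - x.1, pm - x.2)) (fun x => (pp - x.1, pm - x.2)) ?_ ?_ ?_
    ?_ ?_
  · rintro ⟨r', s'⟩ hx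
    simp only [kacTable, Finset.mem_filter, Finset.mem_product, Finset.mem_Ico, not_lt] at hx ⊢
    -- coprimality excludes the diagonal `r' p₋ = s' p₊`
    have hne : s' * (pp : ℤ) ≠ r' * pm := by
      intro h
      have hco : IsCoprime (pp : ℤ) (pm : ℤ) := Nat.isCoprime_iff_coprime.mpr hcop
      have hd : (pp : ℤ) ∣ r' := hco.dvd_of_dvd_mul_right ⟨s', by linarith⟩
      have := Int.le_of_dvd (by omega) hd
      omega
    have hlt := lt_of_le_of_ne hx.2 hne
    refine ⟨by omega, ?_⟩
    nlinarith
  · rintro ⟨r', s'⟩ hx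
    simp only [kacTable, Finset.mem_filter, Finset.mem_product, Finset.mem_Ico, not_lt] at hx ⊢
    refine ⟨by omega, ?_⟩
    nlinarith
  · rintro ⟨r', s'⟩ _
    simp
  · rintro ⟨r', s'⟩ _
    simp
  · rintro ⟨r', s'⟩ _
    simp only
    congr 1
    · rw [← hneg, ← hper _ 1]
      congr 1
      push_cast
      ring
    · rw [← hneg]
      congr 1
      ring

/-- Poisson summation turns the differences of Gaussian sums into a sine series. -/
lemma virCh_neg_one_div_eq_tsum {pp pm : ℕ} (hpp : 1 ≤ pp) (hpm : 1 ≤ pm) (r s : ℤ) {τ : ℂ}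
    (hτ : 0 < τ.im) :
    virCh pp pm r s (-1 / τ) = (alphaFull pp pm * ModularForm.eta τ)⁻¹ *
      (2 * ∑' M : ℤ, (weightInt pp pm r s M : ℂ) *
        jacobiTheta₂_term M 0 (τ / alphaFull pp pm ^ 2)) := by
  have hα := alphaFull_pos hpp hpm
  have hτ' := neg_one_div_im_pos hτ
  have h1 : (pp : ℂ) ≠ 0 := by exact_mod_cast (by omega : pp ≠ 0)
  set a : ℂ := r / pp with ha
  set b : ℂ := s / pm with hb
  set τ2 : ℂ := τ / alphaFull pp pm ^ 2 with hτ2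
  have hS := fun c => (summable_fockTerm hα 0 c hτ').hasSum
  have hsum := ((hS (b - a)).sub (hS (a + b))).tsum_eq
  have hvir : virCh pp pm r s (-1 / τ) = ∑' K : ℤ, (fockTerm (alphaFull pp pm) 0 (b - a - 2 * K)
      (-1 / τ) - fockTerm (alphaFull pp pm) 0 (a + b - 2 * K) (-1 / τ)) := by
    rw [virCh, ← (Equiv.neg ℤ).tsum_eq]
    refine tsum_congr fun K => ?_
    rw [Equiv.neg_apply, fockCh_eq _ _ _ hτ', fockCh_eq _ _ _ hτ', alphaRSN_sub hpp hpm,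
      alphaRSN_sub hpp hpm, fockTerm, fockTerm]
    simp only [mul_zero, zero_mul, Complex.exp_zero, one_mul]
    congr 4
    · rw [ha, hb]
      push_cast
      ring
    · rw [ha, hb]
      push_cast
      rw [sub_div, div_self h1]
      ring
  rw [hvir, hsum, tsum_fockTerm hα _ hτ, tsum_fockTerm hα _ hτ, ← mul_sub]
  congr 1
  have hJ := fun z => hasSum_jacobiTheta₂_term z (im_div_sq_pos hα hτ)
  rw [← hτ2] at hJ
  -- averaging over `M ↦ -M` produces the products of sines
  have hJ4 := ((((hJ ((b - a) / 2)).add (hJ (-((b - a) / 2)))).sub (hJ ((a + b) / 2))).sub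
    (hJ (-((a + b) / 2)))).mul_left (1 / 2)
  rw [jacobiTheta₂_neg_left, jacobiTheta₂_neg_left] at hJ4
  rw [← tsum_mul_left]
  have hterm : ∀ M : ℤ, 1 / 2 * (jacobiTheta₂_term M ((b - a) / 2) τ2 +
      jacobiTheta₂_term M (-((b - a) / 2)) τ2 - jacobiTheta₂_term M ((a + b) / 2) τ2 -
      jacobiTheta₂_term M (-((a + b) / 2)) τ2) =
      2 * ((weightInt pp pm r s M : ℂ) * jacobiTheta₂_term M 0 τ2) := by
    intro M
    have key : ∀ x y : ℂ, jacobiTheta₂_term M ((x + y) / 2) τ2 =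
        cexp (Real.pi * (x * M) * I) * cexp (Real.pi * (y * M) * I) *
          jacobiTheta₂_term M 0 τ2 := by
      intro x y
      rw [jacobiTheta₂_term, jacobiTheta₂_term, ← Complex.exp_add, ← Complex.exp_add]
      congr 1
      ring
    rw [show (b - a) / 2 = (-a + b) / 2 by ring, show -((-a + b) / 2) = (a + -b) / 2 by ring,
      show -((a + b) / 2) = (-a + -b) / 2 by ring, key, key, key, key, weightInt]
    push_cast
    rw [show (Real.pi : ℂ) * (r * M / pp) = Real.pi * (a * M) by rw [ha]; ring,
      show (Real.pi : ℂ) * (s * M / pm) = Real.pi * (b * M) by rw [hb]; ring]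
    simp only [Complex.sin, neg_mul, mul_neg]
    generalize cexp (Real.pi * (a * M) * I) = A
    generalize cexp (-(Real.pi * (a * M) * I)) = A'
    generalize cexp (Real.pi * (b * M) * I) = B
    generalize cexp (-(Real.pi * (b * M) * I)) = B'
    linear_combination (-1 / 2 * (A' - A) * (B' - B) * jacobiTheta₂_term M 0 τ2) * I_sq
  simp_rw [hterm] at hJ4
  rw [hJ4.tsum_eq]
  ring

/-- The modular `S`-transformation of the minimal model characters. -/
theorem virCh_neg_one_div {pp pm : ℕ} (hpp : 1 ≤ pp) (hpm : 1 ≤ pm) (hcop : Nat.Coprime pp pm)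
    (r s : ℤ) {τ : ℂ} (hτ : 0 < τ.im) :
    virCh pp pm r s (-1 / τ) =
      ∑ x ∈ kacTable pp pm, (virS pp pm r s x.1 x.2 : ℂ) * virCh pp pm x.1 x.2 τ := by
  have hα := alphaFull_pos hpp hpm
  have : NeZero (2 * (pp * pm)) := ⟨by positivity⟩
  have hα0 : (alphaFull pp pm : ℂ) ≠ 0 := by exact_mod_cast hα.ne'
  have hs0 := (summable_jacobiTheta₂_term_iff 0 _).mpr (im_div_sq_pos hα hτ)
  have hs : Summable fun M : ℤ => (weightInt pp pm r s M : ℂ) *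
      jacobiTheta₂_term M 0 (τ / alphaFull pp pm ^ 2) := by
    refine Summable.of_norm_bounded hs0.norm fun M => ?_
    rw [norm_mul, weightInt, norm_real, norm_mul]
    refine mul_le_of_le_one_left (norm_nonneg _) (mul_le_one₀ ?_ (norm_nonneg _) ?_)
    · exact Real.abs_sin_le_one _
    · exact Real.abs_sin_le_one _
  set F : ℤ → ℂ := fun M => (weightInt pp pm r s M : ℂ) * classTheta pp pm M τ with hF
  rw [virCh_neg_one_div_eq_tsum hpp hpm r s hτ,
    tsum_int_eq_sum_residues _ (bijective_corner hpp hpm hcop) hs]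
  simp_rw [weightInt_add hpp hpm, tsum_mul_left]
  have hfold := sum_corner_eq hpp hpm hcop (F := F)
    (fun M => by simp only [hF, weightInt_neg, classTheta_neg])
    (fun M l => by simp only [hF, weightInt_add hpp hpm, classTheta_add])
    (fun M h => by simp [hF, weightInt_eq_zero_left hpp r s (Dvd.dvd.mul_left h r)])
    (fun M h => by simp [hF, weightInt_eq_zero_right hpm r s (Dvd.dvd.mul_left h s)])
  rw [← Finset.sum_coe_sort] at hfold
  have hfold' : ∑ x : ↥(Finset.Ico (0 : ℤ) pm ×ˢ Finset.Ico (-(pp : ℤ)) pp),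
      (weightInt pp pm r s (x.1.1 * pp + x.1.2 * pm) : ℂ) * ∑' k : ℤ, jacobiTheta₂_term
        (x.1.1 * pp + x.1.2 * pm + (2 * (pp * pm) : ℕ) * k) 0 (τ / alphaFull pp pm ^ 2) = _ := hfold
  rw [hfold', Finset.mul_sum, Finset.mul_sum, Finset.mul_sum]
  refine Finset.sum_congr rfl fun x _ => ?_
  simp only [hF]
  rw [virCh_eq hpp hpm _ _ hτ, virS_eq hpp hpm, weightInt_corner_neg hpp hpm, mul_inv]
  push_cast
  field_simp
  ring

/-- On the border the `S`-matrix vanishes; for odd `n` the sign comes from `s ↦ p₋ - s`. -/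
lemma virPart_neg_one_div {pp pm : ℕ} (hpp : 1 ≤ pp) (hpm : 1 ≤ pm) (hcop : Nat.Coprime pp pm)
    (r s n : ℤ) {τ : ℂ} (hτ : 0 < τ.im) :
    virPart pp pm r s n (-1 / τ) =
      (if 0 ≤ n then (n : ℂ) else 0) * ∑ x ∈ kacTable pp pm,
          (-1 : ℂ) ^ (n * (pp * x.2 + pm * x.1)) * (virS pp pm r s x.1 x.2 : ℂ) *
            virCh pp pm x.1 x.2 τ := by
  have hborder : (∀ M, weightInt pp pm r s M = 0) → ∑ x ∈ kacTable pp pm,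
      (-1 : ℂ) ^ (n * (pp * x.2 + pm * x.1)) * (virS pp pm r s x.1 x.2 : ℂ) *
        virCh pp pm x.1 x.2 τ = 0 := by
    intro h
    refine Finset.sum_eq_zero fun x _ => ?_
    rw [virS_eq hpp hpm, h]
    simp
  rw [virPart]
  by_cases hr : r = pp
  · rw [if_pos (Or.inl hr), hborder fun M =>
      weightInt_eq_zero_left hpp r s (hr ▸ Dvd.intro M rfl), mul_zero]
  by_cases hs : s = pm
  · rw [if_pos (Or.inr hs), hborder fun M =>
      weightInt_eq_zero_right hpm r s (hs ▸ Dvd.intro M rfl), mul_zero]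
  rw [if_neg (by tauto)]
  by_cases hn : 0 ≤ n
  · rw [if_pos hn, if_pos hn]
    congr 1
    by_cases he : Even n
    · rw [if_pos he, virCh_neg_one_div hpp hpm hcop r s hτ]
      refine Finset.sum_congr rfl fun x _ => ?_
      rw [(he.mul_right _).neg_one_zpow, one_mul]
    · rw [if_neg he, virCh_neg_one_div hpp hpm hcop r (pm - s) hτ, ← Finset.sum_neg_distrib]
      refine Finset.sum_congr rfl fun x _ => ?_
      rw [zpow_mul, (Int.not_even_iff_odd.mp he).neg_one_zpow, virS_eq hpp hpm, virS_eq hpp hpm,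
        weightInt_sub_right hpm, show (pp * x.2 + pm * x.1 : ℤ) = x.2 * pp + x.1 * pm by ring]
      push_cast
      ring
  · rw [if_neg hn, if_neg hn, zero_mul]

end Singlet

end

theorem mainTheorem2 (pp pm : ℕ) (hpp : 1 ≤ pp) (hpm : 1 ≤ pm) (hne : pp ≠ pm)
    (hcop : Nat.Coprime pp pm) (r s n : ℤ) (hr : 1 ≤ r) (hr' : r ≤ pp) (hs : 1 ≤ s)
    (hs' : s ≤ pm) (ε : ℂ) (hε : ε.re ≠ 0) (τ : ℂ) (hτ : 0 < τ.im) :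
    MeasureTheory.Integrable (fun x : ℝ => Singlet.kernelS pp pm ε r s n x *
      Singlet.regFockCh pp pm ε (x + Singlet.alphaZero pp pm / 2) τ) ∧
    DifferentiableAt ℂ
      (fun e => Singlet.thetaSum pp pm n (Singlet.weightSinSin pp pm r s) e τ) ε ∧
    Singlet.regICh pp pm ε r s n (-1 / τ) =
      (if 0 ≤ n then (n : ℂ) else 0) * ∑ x ∈ Singlet.kacTable pp pm,
          (-1 : ℂ) ^ (n * (pp * x.2 + pm * x.1)) * (Singlet.virS pp pm r s x.1 x.2 : ℂ) *
            Singlet.virCh pp pm x.1 x.2 τ +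
      (∫ x : ℝ, Singlet.kernelS pp pm ε r s n x *
        Singlet.regFockCh pp pm ε (x + Singlet.alphaZero pp pm / 2) τ) +
      (1 - (Real.sign ε.re : ℂ)) / 2 * Singlet.correctionY pp pm ε r s n τ := by
  obtain ⟨hint, hseries⟩ := Singlet.tsum_nat_mul_quadTerm hpp hpm r s n hε hτ
  refine ⟨hint, (Singlet.differentiableAt_thetaSum hpp hpm r s n ε hτ).1, ?_⟩
  rw [Singlet.regICh_eq hpp hpm ε r s n (Singlet.neg_one_div_im_pos hτ), hseries,
    Singlet.virPart_neg_one_div hpp hpm hcop r s n hτ, add_assoc]
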